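/- **Conventions.** Diagrams are drawn in English notation: the cell $(i,j)$ lies in row $i$ and column $j$. For partitions $\mu\subseteq\lambda$ and $r\in\mathbb Z$, the *r-shape* $(\lambda/\mu,r)$ is the skew shape $\lambda/\mu$ with the shifted contents $c(i,j)=j-i+r-1+\lambda'_1$ (so the cell $(\lambda_1',1)$ has content $r$). Integer sequences $\mathbf a=(a_i)_{i=1}^n$, $\mathbf b=(b_i)_{i=1}^n$ with $n\ge\lambda_1$ are *column flags* for $\lambda/\mu$ if, for every $i\ge1$ with $\mu'_i<\lambda'_{i+1}$, $$a_i-a_{i+1}\le \mu'_i-\mu'_{i+1}+1,\qquad b_i-b_{i+1}\le\lambda'_i-\lambda'_{i+1}+1 .$$ Put $a'_i=a_i+c(\mu'_i+1,i)$ and $b'_i=b_i+c(\lambda'_i,i)$ (the contents of the top and the bottom cell of column $i$). For variables $\mathbf y=(y_i)_{i\in\mathbb Z}$, $\mathbf z=(z_i)_{i\in\mathbb Z}$ write $\mathbf y_{p,q}=(y_p,\dots,y_q)$, which is empty if $p>q$, and likewise $\mathbf z_{p,q}$. Let $e_m(\mathbf x/\mathbf w)=\sum_{i=0}^m(-1)^{m-i}e_i(\mathbf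 x)h_{m-i}(\mathbf w)$ for $m\ge0$ and $e_m(\mathbf x/\mathbf w)=0$ for $m<0$, where $e_i$ and $h_i$ are the elementary and complete homogeneous symmetric polynomials. The *flagged supersymmetric Schur function* is $$\mathsf S^{\mathbf a,\mathbf b}_{\lambda/\mu}(\mathbf y/\mathbf z)=\det\left[e_{\lambda'_i-i-\mu'_j+j}(\mathbf y_{a_j,b_i}/\mathbf z_{a'_j,b'_i})\right]_{1\le i,j\le n}.$$ **Ribbons.** A *ribbon* is a (nonempty, edgewise) connected skew diagram containing no $2\times2$ block; its *head* is its bottom leftmost cell and its *tail* its top rightmost cell. An *outer ribbon decomposition* $\Theta=(\theta_1,\dots,\theta_k)$ of $\lambda/\mu$ is a partition of its diagram into ribbons such that each head $\delta_i$ of $\theta_i$ lies on the left or bottom perimeter and each tail $\gamma_i$ of $\theta_i$ lies on the top or right perimeter of $\lambda/\mu$ (that is, has no neighbour in the diagram on the respective side). A cell of $\theta_i$ *goes up* if the cell above it is in $\theta_i$ or if it is the tail of $\theta_i$ and lies on the top perimeter; otherwise it *goes right*. (For the top right cell of the diagram the direction is immaterial.) If $\lambda/\mu$ is connected, all cells of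 the same content have the same direction. For contents $p\le q$ of cells of $\lambda/\mu$ let $\Theta(p,q)$ be the ribbon that has one cell of each content $p,\dots,q$ and in which the cell of content $c+1$ is above (respectively to the right of) the cell of content $c$ if the cells of content $c$ in $\lambda/\mu$ go up (respectively right), for $p\le c<q$; it is an r-shape with root content $p$. Let $\Theta(p,q)=\varnothing$ if $p=q+1$, and let $\Theta(p,q)$ be undefined if $p>q+1$. Put $$\theta_i\#\theta_j=\Theta(c(\delta_i),c(\gamma_j)).$$ **Induced ribbon flags.** Let $\rho_1,\rho_2,\dots$ be the columns of $\theta_i\#\theta_j$ from left to right. Let $m_s$ be the leftmost cell of $\lambda/\mu$ that has the content of the top cell of $\rho_s$, and $M_s$ the rightmost cell of $\lambda/\mu$ that has the content of the bottom cell of $\rho_s$. Define $$a^{ij}_s=a_{\mathrm{col}(m_s)}-(\mu'_{\mathrm{col}(m_s)}+1)+\mathrm{row}(m_s),\qquad b^{ij}_s=b_{\mathrm{col}(M_s)}-\lambda'_{\mathrm{col}(M_s)}+\mathrm{row}(M_s).$$ **Theorem (Hamel–Goulden formulas for flagged supersymmetric Schur functions).** Let $\lambda/\mu$ be a connected (nonempty)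 r-shape, $n\ge\lambda_1$, let $\mathbf a,\mathbf b\in\mathbb Z^n$ be column flags for $\lambda/\mu$, and let $(\theta_1,\dots,\theta_k)$ be an outer ribbon decomposition of $\lambda/\mu$. Then $$\mathsf S^{\mathbf a,\mathbf b}_{\lambda/\mu}(\mathbf y/\mathbf z)=\det\left[\mathsf S^{\mathbf a^{ij},\mathbf b^{ij}}_{\theta_i\#\theta_j}(\mathbf y/\mathbf z)\right]_{1\le i,j\le k},$$ where the $(i,j)$ entry is $1$ if $\theta_i\#\theta_j=\varnothing$ and $0$ if $\theta_i\#\theta_j$ is undefined. The identity holds for arbitrary $y_i,z_i$ $(i\in\mathbb Z)$ in any commutative ring. -/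

import Mathlib

open Finset

/-! ### Elementary supersymmetric functions in intervals of variables -/

section Supersymmetric

variable {R : Type*} [CommRing R]

/-- `e_k(x_a, …, x_b)`; the set of variables is empty if `a > b`. -/
noncomputable def esymmInterval (x : ℤ → R) (a b : ℤ) (k : ℕ) : R :=
  ∑ s ∈ (Finset.Icc a b).powersetCard k, ∏ t ∈ s, x t

/-- `h_k(x_a, …, x_b)`; the set of variables is empty if `a > b`. -/
noncomputable def hsymmInterval (x : ℤ → R) (a b : ℤ) (k : ℕ) : R :=
  ∑ s ∈ (Finset.Icc a b).sym k, ((s : Multiset ℤ).map x).prod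

/-- `e_m(y_a, …, y_b / z_{a'}, …, z_{b'}) = ∑_{i=0}^m (-1)^{m-i} e_i(y) h_{m-i}(z)`,
which is zero for negative `m`. -/
noncomputable def superE (y z : ℤ → R) (a b a' b' : ℤ) (m : ℤ) : R :=
  if m < 0 then 0
  else ∑ i ∈ Finset.range (m.toNat + 1),
    (-1) ^ (m.toNat - i) * esymmInterval y a b i * hsymmInterval z a' b' (m.toNat - i)

end Supersymmetric

/-! ### Refined shapes

Rows and columns are numbered from `0`, so a cell `(i, j)` here is the cell in row `i + 1` and
column `j + 1` of the usual numbering. -/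

/-- A refined skew shape `(λ/μ, r)`. -/
structure RShape where
  outer : YoungDiagram
  inner : YoungDiagram
  inner_le : inner ≤ outer
  root : ℤ

namespace RShape

/-- The diagram of `λ/μ`. -/
def cells (S : RShape) : Finset (ℕ × ℕ) := S.outer.cells \ S.inner.cells

/-- The number `λ₁` of columns. -/
def numCols (S : RShape) : ℕ := S.outer.rowLen 0

/-- `j - i + r - 1 + λ'₁`, for arbitrary integers `i`, `j`. -/
def shiftedContent (S : RShape) (i j : ℤ) : ℤ := j - i + S.root - 1 + S.outer.colLen 0

/-- The (shifted) content of a cell. -/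
def content (S : RShape) (x : ℕ × ℕ) : ℤ := S.shiftedContent x.1 x.2

/-- The content of the top cell (in row `μ'_j + 1` of the usual numbering) of column `j`. -/
def topContent (S : RShape) (j : ℕ) : ℤ := S.shiftedContent (S.inner.colLen j) j

/-- The content of the bottom cell (in row `λ'_j` of the usual numbering) of column `j`. -/
def bottomContent (S : RShape) (j : ℕ) : ℤ := S.shiftedContent ((S.outer.colLen j : ℤ) - 1) j

/-- `a` and `b` are column flags for `λ/μ`. -/
def IsColumnFlags (S : RShape) (a b : ℕ → ℤ) : Prop :=
  ∀ i : ℕ, S.inner.colLen i < S.outer.colLen (i + 1) →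
    a i - a (i + 1) ≤ (S.inner.colLen i : ℤ) - S.inner.colLen (i + 1) + 1 ∧
    b i - b (i + 1) ≤ (S.outer.colLen i : ℤ) - S.outer.colLen (i + 1) + 1

/-- The flagged supersymmetric Schur function `S^{a,b}_{λ/μ}(y/z)`, as a determinant of size `n`
(where `n ≥ λ₁`). Only the first `n` entries of the flags are used. The conjugate flags are
`a'_j = a_j + c(top cell of column j)` and `b'_i = b_i + c(bottom cell of column i)`. -/
noncomputable def flaggedSchur {R : Type*} [CommRing R] (S : RShape) (n : ℕ) (a b : ℕ → ℤ) (y z : ℤ → R) : R :=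
  Matrix.det (Matrix.of fun i j : Fin n =>
    superE y z (a j) (b i) (a j + S.topContent j) (b i + S.bottomContent i)
      ((S.outer.colLen i : ℤ) - i - S.inner.colLen j + j))

end RShape

/-! ### Ribbons and outer decompositions -/

/-- Two cells share an edge. -/
def CellAdj (u v : ℕ × ℕ) : Prop :=
  (u.1 = v.1 ∧ (u.2 + 1 = v.2 ∨ v.2 + 1 = u.2)) ∨ (u.2 = v.2 ∧ (u.1 + 1 = v.1 ∨ v.1 + 1 = u.1))

/-- A nonempty edgewise connected set of cells. -/
def CellsConnected (C : Finset (ℕ × ℕ)) : Prop :=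
  C.Nonempty ∧ ∀ x ∈ C, ∀ y ∈ C,
    Relation.ReflTransGen (fun u v => u ∈ C ∧ v ∈ C ∧ CellAdj u v) x y

/-- A connected skew diagram without a `2 × 2` block of cells. -/
def IsRibbon (C : Finset (ℕ × ℕ)) : Prop :=
  CellsConnected C ∧
  (∃ κ ν : YoungDiagram, ν ≤ κ ∧ C = κ.cells \ ν.cells) ∧
  ¬ ∃ i j : ℕ, (i, j) ∈ C ∧ (i + 1, j) ∈ C ∧ (i, j + 1) ∈ C ∧ (i + 1, j + 1) ∈ C

/-- The bottom leftmost cell of a ribbon. -/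
def IsHead (C : Finset (ℕ × ℕ)) (x : ℕ × ℕ) : Prop :=
  x ∈ C ∧ ∀ u ∈ C, u.1 ≤ x.1 ∧ x.2 ≤ u.2

/-- The top rightmost cell of a ribbon. -/
def IsTail (C : Finset (ℕ × ℕ)) (x : ℕ × ℕ) : Prop :=
  x ∈ C ∧ ∀ u ∈ C, x.1 ≤ u.1 ∧ u.2 ≤ x.2

namespace RShape

/-- For a cell `x` of the diagram: `x` lies on the left perimeter. -/
def OnLeft (S : RShape) (x : ℕ × ℕ) : Prop := x.2 = 0 ∨ (x.1, x.2 - 1) ∉ S.cells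

/-- For a cell `x` of the diagram: `x` lies on the top perimeter. -/
def OnTop (S : RShape) (x : ℕ × ℕ) : Prop := x.1 = 0 ∨ (x.1 - 1, x.2) ∉ S.cells

/-- For a cell `x` of the diagram: `x` lies on the right perimeter. -/
def OnRight (S : RShape) (x : ℕ × ℕ) : Prop := (x.1, x.2 + 1) ∉ S.cells

/-- For a cell `x` of the diagram: `x` lies on the bottom perimeter. -/
def OnBottom (S : RShape) (x : ℕ × ℕ) : Prop := (x.1 + 1, x.2) ∉ S.cells

end RShape

/-- An outer ribbon decomposition `(θ_1, …, θ_k)` of `λ/μ`, together with the heads and tails of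
its ribbons (which the ribbons determine). -/
structure OuterDecomposition (S : RShape) (k : ℕ) where
  ribbon : Fin k → Finset (ℕ × ℕ)
  head : Fin k → ℕ × ℕ
  tail : Fin k → ℕ × ℕ
  isRibbon : ∀ i, IsRibbon (ribbon i)
  isHead : ∀ i, IsHead (ribbon i) (head i)
  isTail : ∀ i, IsTail (ribbon i) (tail i)
  disjoint : ∀ i j, i ≠ j → Disjoint (ribbon i) (ribbon j)
  cover : Finset.univ.biUnion ribbon = S.cells
  head_outer : ∀ i, S.OnLeft (head i) ∨ S.OnBottom (head i)
  tail_outer : ∀ i, S.OnTop (tail i) ∨ S.OnRight (tail i)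

/-! ### Ribbons with prescribed directions

A set `up` of contents prescribes the steps of a ribbon: from its cell with content `c` to its cell
with content `c + 1` it goes up if `c ∈ up`, and right otherwise. -/

section Strip

variable (up : ℤ → Prop) [DecidablePred up] (p q : ℤ)

/-- Of the ribbon with contents `p, …, q`, placed so that its tail is in row `0` and its head in
column `0`: the row of the cell with content `c`. -/
noncomputable def stripRow (c : ℤ) : ℕ := #{t ∈ Finset.Ico c q | up t}

/-- Of the ribbon with contents `p, …, q`, placed so that its tail is in row `0` and its head in
column `0`: the column of the cell with content `c`. -/
noncomputable def stripCol (c : ℤ) : ℕ := #{t ∈ Finset.Ico p c | ¬ up t}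

/-- The cells of this ribbon. -/
noncomputable def stripCells : Finset (ℕ × ℕ) :=
  (Finset.Icc p q).image fun c => (stripRow up q c, stripCol up p c)

lemma stripRow_anti {c d : ℤ} (h : c ≤ d) : stripRow up q d ≤ stripRow up q c :=
  Finset.card_le_card (Finset.filter_subset_filter _ (Finset.Ico_subset_Ico_left h))

lemma stripCol_mono {c d : ℤ} (h : c ≤ d) : stripCol up p c ≤ stripCol up p d :=
  Finset.card_le_card (Finset.filter_subset_filter _ (Finset.Ico_subset_Ico_right h))

lemma stripCol_sub_stripRow {c : ℤ} (h₁ : p ≤ c) (h₂ : c ≤ q) :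
    (stripCol up p c : ℤ) - stripRow up q c = c - p - stripRow up q p := by
  have h3 : stripRow up q p = #{t ∈ Finset.Ico p c | up t} + stripRow up q c := by
    unfold stripRow
    rw [← Finset.Ico_union_Ico_eq_Ico h₁ h₂, Finset.filter_union, Finset.card_union_of_disjoint]
    exact Finset.disjoint_filter_filter (Finset.Ico_disjoint_Ico_consecutive p c q)
  have h4 : #{t ∈ Finset.Ico p c | up t} + stripCol up p c = (c - p).toNat := by
    unfold stripCol
    rw [Finset.card_filter_add_card_filter_not, Int.card_Ico]
  omega

lemma stripCells_ordConnected : (stripCells up p q : Set (ℕ × ℕ)).OrdConnected := by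
  refine ⟨?_⟩
  intro u hu v hv x hx
  simp only [stripCells, Finset.coe_image, Set.mem_image, Finset.mem_coe, Finset.mem_Icc] at *
  obtain ⟨c, ⟨hpc, hcq⟩, rfl⟩ := hu
  obtain ⟨d, ⟨hpd, hdq⟩, rfl⟩ := hv
  obtain ⟨⟨h1, h2⟩, h3, h4⟩ := hx
  dsimp only at h1 h2 h3 h4
  have e1 := stripCol_sub_stripRow up p q hpc hcq
  have e2 := stripCol_sub_stripRow up p q hpd hdq
  set e : ℤ := x.2 - x.1 + p + stripRow up q p with he
  rcases le_total c d with hcd | hcd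
  · have r1 := stripRow_anti up q hcd
    have hce : c ≤ e := by omega
    have hed : e ≤ d := by omega
    have r2 := stripRow_anti up q hce
    have r3 := stripRow_anti up q hed
    have e3 := stripCol_sub_stripRow up p q (hpc.trans hce) (hed.trans hdq)
    exact ⟨e, ⟨hpc.trans hce, hed.trans hdq⟩, Prod.ext (by dsimp only; omega)
      (by dsimp only; omega)⟩
  · have r1 := stripCol_mono up p hcd
    have hce : e ≤ c := by omega
    have hed : d ≤ e := by omega
    have r2 := stripCol_mono up p hce
    have r3 := stripCol_mono up p hed
    have e3 := stripCol_sub_stripRow up p q (hpd.trans hed) (hce.trans hcq)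
    exact ⟨e, ⟨hpd.trans hed, hce.trans hcq⟩, Prod.ext (by dsimp only; omega)
      (by dsimp only; omega)⟩

/-- The r-shape whose diagram is the ribbon with contents `p, …, q` and directions `up`, with root
content `p`: `λ` is the smallest Young diagram containing the ribbon, and `μ` is what is left of `λ`
when the ribbon is removed. -/
noncomputable def stripShape : RShape where
  outer :=
    { cells := (stripCells up p q).biUnion fun s => Finset.Iic s
      isLowerSet := by
        intro x w hwx hx
        simp only [Finset.coe_biUnion, Finset.mem_coe, Finset.coe_Iic, Set.mem_iUnion,
          Set.mem_Iic, exists_prop] at hx ⊢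
        obtain ⟨s, hs, hxs⟩ := hx
        exact ⟨s, hs, hwx.trans hxs⟩ }
  inner :=
    { cells := ((stripCells up p q).biUnion fun s => Finset.Iic s) \ stripCells up p q
      isLowerSet := by
        intro x w hwx hx
        simp only [Finset.coe_sdiff, Finset.coe_biUnion, Set.mem_sdiff, Finset.mem_coe,
          Finset.coe_Iic, Set.mem_iUnion, Set.mem_Iic, exists_prop] at hx ⊢
        obtain ⟨⟨s, hs, hxs⟩, hx⟩ := hx
        exact ⟨⟨s, hs, hwx.trans hxs⟩, fun hw =>
          hx ((stripCells_ordConnected up p q).out hw hs ⟨hwx, hxs⟩)⟩ }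
  inner_le := by
    intro x hx
    exact Finset.sdiff_subset hx
  root := p

lemma stripShape_cells : (stripShape up p q).cells = stripCells up p q := by
  refine Finset.sdiff_sdiff_eq_self ?_
  intro s hs
  exact Finset.mem_biUnion.2 ⟨s, hs, Finset.mem_Iic.2 le_rfl⟩

end Strip

/-! ### The cutting strip, the operation `#`, and induced ribbon flags -/

namespace RShape

/-- The leftmost cell with content `c` in the diagram (for contents that occur). -/
noncomputable def leftmostCell (S : RShape) (c : ℤ) : ℕ × ℕ :=
  if h : ({x ∈ S.cells | S.content x = c}).Nonempty then
    (Finset.exists_min_image _ Prod.snd h).choose else (0, 0)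

/-- The rightmost cell with content `c` in the diagram (for contents that occur). -/
noncomputable def rightmostCell (S : RShape) (c : ℤ) : ℕ × ℕ :=
  if h : ({x ∈ S.cells | S.content x = c}).Nonempty then
    (Finset.exists_max_image _ Prod.snd h).choose else (0, 0)

end RShape

namespace OuterDecomposition

variable {S : RShape} {k : ℕ} (Θ : OuterDecomposition S k)

/-- A cell goes up if the cell above it is in the same ribbon, or if it is the tail of its ribbon
and lies on the top perimeter. -/
def GoesUp (x : ℕ × ℕ) : Prop :=
  ∃ i, x ∈ Θ.ribbon i ∧
    ((0 < x.1 ∧ (x.1 - 1, x.2) ∈ Θ.ribbon i) ∨ (x = Θ.tail i ∧ S.OnTop x))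

/-- The directions of the cutting strip: its cell with content `c` goes up precisely when the cells
with content `c` in the diagram do. (They all have the same direction in a connected diagram. The
direction at the largest content, that of the top right cell of the diagram, concerns the last cell
of the cutting strip and does not matter.) -/
def StripUp (c : ℤ) : Prop := ∃ x ∈ S.cells, S.content x = c ∧ Θ.GoesUp x

open Classical in
/-- `Θ(p, q)` for `p ≤ q`: the part of the cutting strip with contents in `[p, q]`. -/
noncomputable def subStrip (p q : ℤ) : RShape := stripShape Θ.StripUp p q

/-- `θ_i # θ_j = Θ(c(δ_i), c(γ_j))`, where `δ_i` is the head of `θ_i` and `γ_j` the tail of `θ_j`. -/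
noncomputable def hash (i j : Fin k) : RShape :=
  Θ.subStrip (S.content (Θ.head i)) (S.content (Θ.tail j))

/-- The induced ribbon flag `a^{ij}`. The vertical ribbons of the canonical decomposition of
`θ_i # θ_j` are its columns, and `m` is the leftmost cell of `λ/μ` with the content of the top cell
of the `r`-th one. (The terms `+ 1` in `μ'_{col m} + 1` and in the usual row number `m.1 + 1`
cancel.) -/
noncomputable def inducedA (a : ℕ → ℤ) (i j : Fin k) (r : ℕ) : ℤ :=
  let m := S.leftmostCell ((Θ.hash i j).topContent r)
  a m.2 - ((S.inner.colLen m.2 : ℤ) + 1) + ((m.1 : ℤ) + 1)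

/-- The induced ribbon flag `b^{ij}`, where `M` is the rightmost cell of `λ/μ` with the content of
the bottom cell of the `r`-th column of `θ_i # θ_j`. -/
noncomputable def inducedB (b : ℕ → ℤ) (i j : Fin k) (r : ℕ) : ℤ :=
  let M := S.rightmostCell ((Θ.hash i j).bottomContent r)
  b M.2 - (S.outer.colLen M.2 : ℤ) + ((M.1 : ℤ) + 1)

/-- The flagged supersymmetric Schur function of `θ_i # θ_j` with the induced ribbon flags; it is
`1` if `θ_i # θ_j` is empty and `0` if it is undefined. -/
noncomputable def entry {R : Type*} [CommRing R] (a b : ℕ → ℤ) (y z : ℤ → R) (i j : Fin k) : R :=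
  let p := S.content (Θ.head i)
  let q := S.content (Θ.tail j)
  if p ≤ q then
    (Θ.hash i j).flaggedSchur (Θ.hash i j).numCols (Θ.inducedA a i j) (Θ.inducedB b i j) y z
  else if p = q + 1 then 1
  else 0

end OuterDecomposition

/-! ### Determinants of link matrices -/

/-! The flags at the top or bottom of a column of `θ_i # θ_j` depend only on the content there.
Hence all determinants involved are built from one array `H x t` (`RShape.columnFunction`), the
function of a column with contents `x, …, t - 1`. The only facts needed about `H` are `H x x = 1`
and `H x t = 0` for `t < x`; the theorem is an identity for unitriangular arrays. The left side is
the determinant of `H` taken between bottoms and tops of columns. The function of a ribbon with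
contents `p, …, q` is the minor of `H` with rows `p, d₁, …, d_r` and columns `d₁, …, d_r, q + 1`,
where the `d_i` are the contents entered from the left (`stripShape_det`).

Both sides become determinants of matrices indexed by all cells (`linkMatrix`), which collapse to a
determinant over heads and tails when the links form chains (`det_linkMatrix_eq_det_chains`). Upward
links give the columns, hence the left side; links along the ribbons give the right side. The
passage from one to the other turns one diagonal at a time from "up" to "right". Making `d` a break
replaces `F x y` by `F x d * F d y - F x y` for `x < d < y` (`isPivotPair_ribbonEntry`), the rule
for joining two ribbons, and this is a pivot operation on the link matrix
(`RShape.det_link_insert`). Since neighbouring diagonals of a connected skew shape interlace, only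
four configurations occur. The ribbon links are reached in this way because cells of equal content
have equal direction (`OuterDecomposition.stripUp_iff`). -/

section LinkMatrix

variable {R : Type*} [CommRing R] {K : Type*}

open Classical in
/-- The matrix attached to a relation `ℓ` (where `ℓ v w` says that `w` is the successor of `v`): the
entry at `(w, v)` is `F (c w) (c v + 1)` if `w` has no predecessor and `v` has no successor, and
`-1` if `w` is the successor of `v`. -/
noncomputable def linkMatrix (c : K → ℤ) (F : ℤ → ℤ → R) (ℓ : K → K → Prop) : Matrix K K R :=
  Matrix.of fun w v =>
    (if (∀ u, ¬ ℓ u w) ∧ (∀ u, ¬ ℓ v u) then F (c w) (c v + 1) else 0) - if ℓ v w then 1 else 0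

lemma linkMatrix_of_link (c : K → ℤ) (F : ℤ → ℤ → R) {ℓ : K → K → Prop} {v w : K} (h : ℓ v w) :
    linkMatrix c F ℓ w v = -1 := by
  have : ¬ ((∀ u, ¬ ℓ u w) ∧ (∀ u, ¬ ℓ v u)) := fun h' => h'.1 v h
  simp [linkMatrix, h, this]

lemma linkMatrix_of_head_of_tail (c : K → ℤ) (F : ℤ → ℤ → R) {ℓ : K → K → Prop} {v w : K}
    (hw : ∀ u, ¬ ℓ u w) (hv : ∀ u, ¬ ℓ v u) : linkMatrix c F ℓ w v = F (c w) (c v + 1) := by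
  simp [linkMatrix, hw, hv]

lemma linkMatrix_of_pred (c : K → ℤ) (F : ℤ → ℤ → R) {ℓ : K → K → Prop} {u v w : K}
    (hu : ℓ u w) (h : ¬ ℓ v w) : linkMatrix c F ℓ w v = 0 := by
  have : ¬ ((∀ u, ¬ ℓ u w) ∧ (∀ u, ¬ ℓ v u)) := fun h' => h'.1 u hu
  simp [linkMatrix, h, this]

lemma linkMatrix_of_succ (c : K → ℤ) (F : ℤ → ℤ → R) {ℓ : K → K → Prop} {u v w : K}
    (hu : ℓ v u) (h : ¬ ℓ v w) : linkMatrix c F ℓ w v = 0 := by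
  have : ¬ ((∀ u, ¬ ℓ u w) ∧ (∀ u, ¬ ℓ v u)) := fun h' => h'.2 u hu
  simp [linkMatrix, h, this]

/-- The fibres are switched on one at a time; each contributes a permutation of a subtype, extended
by the identity without change of sign. -/
lemma sign_sigmaCongrRight {ι : Type*} [Fintype ι] [DecidableEq ι] {β : ι → Type*}
    [∀ i, Fintype (β i)] [∀ i, DecidableEq (β i)] (F : ∀ i, Equiv.Perm (β i)) :
    Equiv.Perm.sign (Equiv.Perm.sigmaCongrRight F) = ∏ i, Equiv.Perm.sign (F i) := by
  have key : ∀ s : Finset ι, Equiv.Perm.sign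
      (Equiv.Perm.sigmaCongrRight fun i => if i ∈ s then F i else 1) =
        ∏ i ∈ s, Equiv.Perm.sign (F i) := by
    intro s
    induction s using Finset.induction_on with
    | empty =>
      have : (Equiv.Perm.sigmaCongrRight fun i => (1 : Equiv.Perm (β i))) = 1 := by
        ext1 ⟨i, x⟩
        rfl
      simp [this]
    | insert a s ha ih =>
      have h1 : (Equiv.Perm.sigmaCongrRight fun i => if i ∈ insert a s then F i else 1) =
          (F a).extendDomain (p := fun x : Σ i, β i => x.1 = a) (Equiv.sigmaSubtype a).symm *
            Equiv.Perm.sigmaCongrRight fun i => if i ∈ s then F i else 1 := by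
        ext1 ⟨i, x⟩
        by_cases hi : i = a
        · subst hi
          have := Equiv.Perm.extendDomain_apply_image (F i)
            (p := fun x : Σ i, β i => x.1 = i) (Equiv.sigmaSubtype i).symm x
          rw [Equiv.Perm.mul_apply]
          simp only [Equiv.Perm.sigmaCongrRight, Equiv.sigmaCongrRight_apply, ha, if_false, id,
            Finset.mem_insert_self, if_true, Equiv.Perm.coe_one]
          exact this.symm
        · rw [Equiv.Perm.mul_apply, Equiv.Perm.extendDomain_apply_not_subtype]
          · simp [hi]
          · simpa using hi
      rw [h1, Equiv.Perm.sign_mul, Equiv.Perm.sign_extendDomain, ih, Finset.prod_insert ha]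
  simpa using key Finset.univ

variable [Fintype K] [DecidableEq K]

/-- The determinant of a matrix whose indices form chains (the rows of the non-initial elements
being those of the negative of the shift along the chains). -/
lemma det_sigma_chain {ι : Type*} [Fintype ι] [DecidableEq ι] (m : ι → ℕ) (A : Matrix ι ι R)
    (M : Matrix (Σ i, Fin (m i + 1)) (Σ i, Fin (m i + 1)) R)
    (h0 : ∀ i j, M ⟨i, 0⟩ ⟨j, Fin.last _⟩ = A i j)
    (hs : ∀ i (k : Fin (m i)) v, M ⟨i, k.succ⟩ v = if v = ⟨i, k.castSucc⟩ then -1 else 0) :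
    M.det = A.det := by
  -- Rotating every chain puts the row of its initial element last. The remaining rows then form
  -- minus the identity against the non-final columns and vanish on the final ones. The signs of the
  -- rotations cancel the determinant of that block.
  set σ : Equiv.Perm (Σ i, Fin (m i + 1)) :=
    Equiv.Perm.sigmaCongrRight fun i => finRotate (m i + 1) with hσ
  have h1 := Matrix.det_permute σ M
  have hsign : ((Equiv.Perm.sign σ : ℤ) : R) = ∏ i, (-1) ^ m i := by
    rw [hσ, sign_sigmaCongrRight]
    simp
  have hlast : ∀ i v, M (σ ⟨i, Fin.last _⟩) v = M ⟨i, 0⟩ v := by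
    intro i v
    simp [hσ]
  have hsucc : ∀ i (k : Fin (m i)) v, M (σ ⟨i, k.castSucc⟩) v =
      if v = ⟨i, k.castSucc⟩ then -1 else 0 := by
    intro i k v
    rw [← hs]
    simp [hσ]
  have h2 := Matrix.twoBlockTriangular_det (M.submatrix σ id)
    (fun v => v.2 = Fin.last _) (by
      rintro ⟨i, k⟩ hk ⟨j, l⟩ hl
      obtain ⟨k', rfl⟩ : ∃ k' : Fin (m i), k'.castSucc = k := Fin.exists_castSucc_eq.2 hk
      obtain rfl : l = Fin.last _ := hl
      rw [Matrix.submatrix_apply, hsucc, if_neg]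
      rintro h
      obtain rfl := congrArg Sigma.fst h
      simp only [id, Sigma.mk.injEq, heq_eq_eq, true_and] at h
      exact (Fin.castSucc_lt_last k').ne' h)
  let e : ι ≃ {v : Σ i, Fin (m i + 1) // v.2 = Fin.last _} :=
    { toFun := fun i => ⟨⟨i, Fin.last _⟩, rfl⟩
      invFun := fun v => v.1.1
      left_inv := fun i => rfl
      right_inv := by
        rintro ⟨⟨i, k⟩, hk⟩
        obtain rfl : k = Fin.last _ := hk
        rfl }
  let e' : (Σ i, Fin (m i)) ≃ {v : Σ i, Fin (m i + 1) // ¬ v.2 = Fin.last _} :=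
    { toFun := fun x => ⟨⟨x.1, x.2.castSucc⟩, (Fin.castSucc_lt_last x.2).ne⟩
      invFun := fun v => ⟨v.1.1, v.1.2.castPred v.2⟩
      left_inv := fun i => rfl
      right_inv := fun v => rfl }
  rw [← Matrix.det_submatrix_equiv_self e, ← Matrix.det_submatrix_equiv_self e'] at h2
  have h3 : ((Matrix.toSquareBlockProp (M.submatrix σ id) fun v => v.2 = Fin.last _).submatrix
      e e) = A := by
    ext i j
    rw [← h0, ← hlast]
    rfl
  have h4 : ((Matrix.toSquareBlockProp (M.submatrix σ id)
      fun v => ¬ v.2 = Fin.last _).submatrix e' e') = -1 := by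
    ext ⟨i, k⟩ ⟨j, l⟩
    refine (hsucc i k ⟨j, l.castSucc⟩).trans ?_
    rw [Matrix.neg_apply, Matrix.one_apply]
    by_cases hij : i = j
    · subst hij
      simp [eq_comm]
      split_ifs <;> simp
    · simp [hij, Ne.symm hij]
  rw [h1, h3, h4, hsign, Matrix.det_neg, Matrix.det_one, Fintype.card_sigma] at h2
  simp only [Fintype.card_fin, Finset.prod_pow_eq_pow_sum, mul_one] at h2
  have h5 : ((-1 : R) ^ ∑ i, m i) * (-1) ^ ∑ i, m i = 1 := by
    rw [← mul_pow]; simp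
  linear_combination (-1 : R) ^ (∑ i, m i) * h2 + (A.det - M.det) * h5

/-- If the links join the elements into chains, and the `i`-th chain has one element for every
value of `c` from `p i` to `q i`, then the determinant of the link matrix is the determinant of
`F (p i) (q j + 1)`. -/
lemma det_linkMatrix_eq_det_chains {ι : Type*} [Fintype ι] [DecidableEq ι] (c : K → ℤ)
    (F : ℤ → ℤ → R) (ℓ : K → K → Prop) (chain : K → ι) (p q : ι → ℤ) (hpq : ∀ i, p i ≤ q i)
    (hmem : ∀ w, p (chain w) ≤ c w ∧ c w ≤ q (chain w))
    (hex : ∀ i x, p i ≤ x → x ≤ q i → ∃ w, chain w = i ∧ c w = x)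
    (hinj : ∀ v w, chain v = chain w → c v = c w → v = w)
    (hℓ : ∀ v w, ℓ v w ↔ chain v = chain w ∧ c w = c v + 1) :
    (linkMatrix c F ℓ).det = (Matrix.of fun i j => F (p i) (q j + 1)).det := by
  have hex' : ∀ v : Σ i, Fin ((q i - p i).toNat + 1), ∃ w, chain w = v.1 ∧ c w = p v.1 + v.2 := by
    rintro ⟨i, k⟩
    have h1 := k.2
    have h2 := hpq i
    apply hex <;> dsimp only <;> omega
  choose f hf1 hf2 using hex'
  have hbij : Function.Bijective f := by
    constructor
    · rintro ⟨i, k⟩ ⟨j, l⟩ h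
      have h1 := hf1 ⟨i, k⟩
      have h2 := hf2 ⟨i, k⟩
      rw [h, hf1] at h1
      obtain rfl : j = i := h1
      rw [h, hf2] at h2
      have : l = k := Fin.ext (by simpa using h2)
      rw [this]
    · intro w
      have h1 := hmem w
      refine ⟨⟨chain w, ⟨(c w - p (chain w)).toNat, by omega⟩⟩, hinj _ _ (hf1 _) ?_⟩
      rw [hf2]
      dsimp only
      omega
  rw [← Matrix.det_submatrix_equiv_self (Equiv.ofBijective f hbij)]
  have hhead : ∀ i u, ¬ ℓ u (f ⟨i, 0⟩) := by
    intro i u h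
    rw [hℓ, hf1, hf2] at h
    have := hmem u
    rw [h.1] at this
    simp only [Fin.val_zero, Nat.cast_zero, add_zero] at h this
    omega
  have htail : ∀ i u, ¬ ℓ (f ⟨i, Fin.last _⟩) u := by
    intro i u h
    rw [hℓ, hf1, hf2] at h
    have := hmem u
    rw [← h.1] at this
    have h1 := hpq i
    simp at h
    simp at this
    omega
  have hstep : ∀ i (k : Fin ((q i - p i).toNat)) v, ℓ (f v) (f ⟨i, k.succ⟩) ↔ v = ⟨i, k.castSucc⟩ := by
    intro i k v
    rw [hℓ, hf1, hf1, hf2, hf2]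
    constructor
    · rintro ⟨h1, h2⟩
      obtain ⟨j, l⟩ := v
      obtain rfl : j = i := h1
      have : l = k.castSucc := Fin.ext (by simp at h2 ⊢; omega)
      rw [this]
    · rintro rfl
      simp
      ring
  apply det_sigma_chain
  · intro i j
    have h1 := hpq j
    refine (linkMatrix_of_head_of_tail c F (hhead i) (htail j)).trans ?_
    rw [hf2, hf2]
    simp
    congr 1
    omega
  · intro i k v
    change linkMatrix c F ℓ (f _) (f _) = _
    split_ifs with h
    · exact linkMatrix_of_link c F ((hstep i k v).2 h)
    · exact linkMatrix_of_pred c F ((hstep i k _).2 rfl) (mt (hstep i k v).1 h)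

end LinkMatrix

/-! ### Pivoting a link matrix at one level -/

section Flip

variable {R : Type*} [CommRing R]

/-- `F` and `F'` are related by a pivot at the index `d`. -/
structure IsPivotPair (d : ℤ) (F F' : ℤ → ℤ → R) : Prop where
  self : F d d = 1
  zero : ∀ x y, y < x → F x y = 0
  pivot : ∀ x y, x < d → d < y → F' x y = F x d * F d y - F x y
  eq : ∀ x y, ¬ (x < d ∧ d < y) → F' x y = F x y

lemma IsPivotPair.symm {d : ℤ} {F F' : ℤ → ℤ → R} (h : IsPivotPair d F F') :
    IsPivotPair d F' F where
  self := by rw [h.eq _ _ (by omega), h.self]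
  zero x y hxy := by rw [h.eq _ _ (by omega), h.zero _ _ hxy]
  pivot x y hx hy := by
    rw [h.pivot x y hx hy, h.eq x d (by omega), h.eq d y (by omega)]
    ring
  eq x y hxy := (h.eq x y hxy).symm

lemma IsPivotPair.transpose {d : ℤ} {F F' : ℤ → ℤ → R} (h : IsPivotPair d F F') :
    IsPivotPair (1 - d) (fun x y => F (1 - y) (1 - x)) (fun x y => F' (1 - y) (1 - x)) where
  self := by simpa using h.self
  zero x y hxy := h.zero _ _ (by omega)
  pivot x y hx hy := by
    rw [h.pivot _ _ (by omega) (by omega), sub_sub_cancel, mul_comm]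
  eq x y hxy := h.eq _ _ (by omega)

variable {K : Type*}

/-- Reversing the links exchanges heads and tails and negates levels. The arguments `(c w, c v + 1)`
are then recovered by `x ↦ 1 - x`, not by `x ↦ -x`, because of the `+ 1` at the tail. -/
lemma linkMatrix_transpose (c : K → ℤ) (F : ℤ → ℤ → R) (ℓ : K → K → Prop) :
    (linkMatrix c F ℓ).transpose =
      linkMatrix (fun w => - c w) (fun x y => F (1 - y) (1 - x)) (fun v w => ℓ w v) := by
  ext v w
  simp only [linkMatrix, Matrix.transpose_apply, Matrix.of_apply]
  have h1 : (1 - (- c w + 1) : ℤ) = c w := by ring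
  have h2 : (1 - - c v : ℤ) = c v + 1 := by ring
  rw [h1, h2]
  by_cases hh : ∀ u, ¬ ℓ u w <;> by_cases ht : ∀ u, ¬ ℓ v u <;> simp [hh, ht]

/-- Two relations that raise `c` by `1` and differ at most in the links from level `d - 1` to
level `d`. -/
structure LinksAgreeOff (c : K → ℤ) (d : ℤ) (ℓ ℓ' : K → K → Prop) : Prop where
  step : ∀ v w, ℓ v w → c w = c v + 1
  step' : ∀ v w, ℓ' v w → c w = c v + 1
  agree : ∀ v w, c w ≠ d → (ℓ' v w ↔ ℓ v w)

lemma LinksAgreeOff.symm {c : K → ℤ} {d : ℤ} {ℓ ℓ' : K → K → Prop}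
    (h : LinksAgreeOff c d ℓ ℓ') : LinksAgreeOff c d ℓ' ℓ :=
  ⟨h.step', h.step, fun v w hw => (h.agree v w hw).symm⟩

lemma LinksAgreeOff.transpose {c : K → ℤ} {d : ℤ} {ℓ ℓ' : K → K → Prop}
    (h : LinksAgreeOff c d ℓ ℓ') :
    LinksAgreeOff (fun w => - c w) (1 - d) (fun v w => ℓ w v) (fun v w => ℓ' w v) where
  step v w hvw := by have := h.step _ _ hvw; omega
  step' v w hvw := by have := h.step' _ _ hvw; omega
  agree v w hw := by
    by_cases hv : c v = d
    · have h1 : ¬ ℓ w v := fun h' => by have := h.step _ _ h'; omega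
      have h2 : ¬ ℓ' w v := fun h' => by have := h.step' _ _ h'; omega
      simp [h1, h2]
    · exact h.agree w v hv

lemma LinksAgreeOff.agree_left {c : K → ℤ} {d : ℤ} {ℓ ℓ' : K → K → Prop}
    (h : LinksAgreeOff c d ℓ ℓ') {v : K} (hv : c v ≠ d - 1) (w : K) : ℓ' v w ↔ ℓ v w := by
  by_cases hw : c w = d
  · have h1 : ¬ ℓ v w := fun h' => by have := h.step _ _ h'; omega
    have h2 : ¬ ℓ' v w := fun h' => by have := h.step' _ _ h'; omega
    simp [h1, h2]
  · exact h.agree v w hw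

variable [Fintype K] [DecidableEq K]

lemma det_mul_signs (s : K → R) (hs : ∀ w, s w * s w = 1) (M : Matrix K K R) :
    (Matrix.of fun w v => s w * (s v * M w v)).det = M.det := by
  have h1 := Matrix.det_mul_column s (Matrix.of fun w v => s v * M w v)
  rw [Matrix.det_mul_row s M, ← mul_assoc, ← Finset.prod_mul_distrib] at h1
  simpa [hs] using h1

/-- The cyclic shift of `m + 1` rows has sign `(-1) ^ m`, which is cancelled by the negation of `m`
of them. -/
lemma det_rotate {m : ℕ} {P : K → Prop} [DecidablePred P] (e : Fin (m + 1) ≃ {w // P w})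
    (M N : Matrix K K R) (h0 : ∀ w v, ¬ P w → N w v = M w v)
    (hlast : ∀ v, N (e 0) v = M (e (Fin.last m)) v)
    (hsucc : ∀ (i : Fin m) v, N (e i.succ) v = - M (e i.castSucc) v) : N.det = M.det := by
  set σ : Equiv.Perm K := (finRotate (m + 1)).extendDomain e with hσ
  have h1 := Matrix.det_permute σ N
  rw [hσ, Equiv.Perm.sign_extendDomain, ← hσ, sign_finRotate] at h1
  let ε : K → R := fun w => if w ∈ univ.image (fun i : Fin m => (e i.castSucc : K)) then -1 else 1
  have hε : ∏ w, ε w = (-1) ^ m := by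
    rw [Finset.prod_ite, Finset.prod_const, Finset.prod_const_one, mul_one, Finset.filter_mem_eq_inter,
      Finset.univ_inter, Finset.card_image_of_injective]
    · simp
    · exact Subtype.val_injective.comp (e.injective.comp (Fin.castSucc_injective m))
  have h2 : N.submatrix σ id = Matrix.of fun w v => ε w * M w v := by
    ext w v
    rw [Matrix.submatrix_apply, Matrix.of_apply, id]
    by_cases hw : P w
    · obtain ⟨j, hj⟩ := e.surjective ⟨w, hw⟩
      obtain rfl : (e j : K) = w := by rw [hj]
      rw [hσ, Equiv.Perm.extendDomain_apply_image]
      obtain ⟨i, rfl⟩ | rfl := Fin.eq_castSucc_or_eq_last j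
      · have : ε (e i.castSucc) = -1 := if_pos (mem_image.2 ⟨i, mem_univ _, rfl⟩)
        rw [this, neg_one_mul, ← hsucc]
        simp
      · have : ε (e (Fin.last m)) = 1 := by
          refine if_neg fun h => ?_
          obtain ⟨i, -, hi⟩ := mem_image.1 h
          exact (Fin.castSucc_lt_last i).ne (e.injective (Subtype.ext hi))
        rw [this, one_mul, ← hlast, finRotate_last]
    · have : ε w = 1 := by
        refine if_neg fun h => ?_
        obtain ⟨i, -, hi⟩ := mem_image.1 h
        exact hw (hi ▸ (e i.castSucc).2)
      rw [hσ, Equiv.Perm.extendDomain_apply_not_subtype _ _ hw, this, one_mul, h0 _ _ hw]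
  rw [h2, Matrix.det_mul_column, hε] at h1
  have h5 : ((-1 : R) ^ m) * (-1) ^ m = 1 := by
    rw [← mul_pow]; simp
  simp at h1
  linear_combination (-1) ^ m * (-h1) + (M.det - N.det) * h5

variable {c : K → ℤ} {d : ℤ} {F F' : ℤ → ℤ → R} {ℓ ℓ' : K → K → Prop}

open Classical in
/-- The row operations behind a pivot: after a change of signs in the rows and columns below level
`d`, multiples of the row of an element `w₀` at level `d` without predecessor are added to the other
rows. -/
lemma exists_pivot_matrix (hF : IsPivotPair d F F') (hℓ : LinksAgreeOff c d ℓ ℓ') {w₀ : K}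
    (hc : c w₀ = d) (hw₀ : ∀ u, ¬ ℓ' u w₀) :
    ∃ N : Matrix K K R, N.det = (linkMatrix c F' ℓ').det ∧
      (∀ w v, c w ≠ d → c v ≠ d - 1 → N w v = linkMatrix c F ℓ w v) ∧
      (∀ w v, c w ≠ d → c v = d - 1 → N w v = 0) ∧
      (∀ v, c v ≠ d - 1 → N w₀ v = if (∀ u, ¬ ℓ v u) then F d (c v + 1) else 0) ∧
      (∀ v, c v = d - 1 → N w₀ v = if (∀ u, ¬ ℓ' v u) then -1 else 0) ∧
      (∀ w u v, ℓ' u w → c w = d → N w v = if ℓ' v w then 1 else 0) := by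
  -- A link has both ends on the same side of `d` unless it enters level `d`, so these signs change
  -- only the links from level `d - 1` to `d`. They also change the sign of `F' x y` for `x < d <
  -- y`, where `F x y` occurs in it with a minus.
  let s : K → R := fun w => if c w < d then -1 else 1
  have hs : ∀ w, s w * s w = 1 := by intro w; simp only [s]; split_ifs <;> ring
  -- In the tail columns the row of `w₀` is `F d y` above level `d - 1` and `-1` on level `d - 1`.
  -- Adding `F x d` times this row to the row of a head at level `x < d` turns `-F' x y` into `F x
  -- y` and clears the columns of level `d - 1`.
  let f : K → R := fun w => if c w ≠ d ∧ ∀ u, ¬ ℓ u w then F (c w) d else 0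
  let M := Matrix.of fun w v => s w * (s v * linkMatrix c F' ℓ' w v)
  have hM : ∀ v, M w₀ v = s v * if (∀ u, ¬ ℓ' v u) then F d (c v + 1) else 0 := by
    intro v
    simp only [M, Matrix.of_apply, linkMatrix, hw₀, not_false_eq_true, implies_true, true_and,
      if_false, sub_zero, hc, s, lt_irrefl, one_mul]
    rw [hF.eq d _ (by omega)]
  have hsv : ∀ v, c v = d - 1 → s v = -1 := fun v hv => if_pos (by omega)
  have hF1 : ∀ v, c v = d - 1 → F d (c v + 1) = 1 := by
    intro v hv
    rw [hv, sub_add_cancel, hF.self]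
  have hfw : ∀ w, c w ≠ d → f w = if (∀ u, ¬ ℓ u w) then F (c w) d else 0 := by
    intro w hw
    simp [f, hw]
  refine ⟨Matrix.of fun w v => M w v + f w * M w₀ v, ?_, ?_, ?_, ?_, ?_, ?_⟩
  · rw [← det_mul_signs s hs (linkMatrix c F' ℓ')]
    exact Matrix.det_eq_of_forall_row_eq_smul_add_const f w₀ (by simp [f, hc]) fun _ _ => rfl
  · intro w v hw hv
    rw [Matrix.of_apply, hM]
    rw [hfw w hw]
    simp only [M, Matrix.of_apply, linkMatrix, hℓ.agree _ w hw, hℓ.agree_left hv]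
    have h1 : ℓ v w → s w * s v = 1 := by
      intro h
      have := hℓ.step _ _ h
      simp only [s]
      split_ifs
      · ring
      · omega
      · omega
      · ring
    by_cases hvw : ℓ v w
    · have : ¬ ∀ u, ¬ ℓ v u := fun h => h w hvw
      simp only [this, hvw, and_false, if_true, if_false]
      linear_combination - h1 hvw
    by_cases hh : ∀ u, ¬ ℓ u w
    · by_cases ht : ∀ u, ¬ ℓ v u
      · rw [if_neg hvw, if_pos (And.intro hh ht), if_pos (And.intro hh ht), if_pos hh, if_pos ht, sub_zero, sub_zero]
        simp only [s]
        by_cases hx : c w < d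
        · by_cases hy : c v < d
          · rw [if_pos hx, if_pos hy, hF.zero d (c v + 1) (by omega), hF.eq _ _ (by omega)]
            ring
          · rw [if_pos hx, if_neg hy, hF.pivot _ _ hx (by omega)]
            ring
        · rw [hF.zero (c w) d (by omega), hF.eq _ _ (by omega), if_neg hx]
          by_cases hy : c v < d
          · rw [hF.zero (c w) _ (by omega)]; ring
          · rw [if_neg hy]; ring
      · simp [ht, hvw]
    · simp [hh, hvw]
  · intro w v hw hv
    rw [Matrix.of_apply, hM]
    have hvw : ¬ ℓ' v w := fun h => hw (by have := hℓ.step' _ _ h; omega)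
    rw [hfw w hw]
    simp only [M, Matrix.of_apply, linkMatrix, hvw, hℓ.agree _ w hw, if_false, sub_zero,
      hsv v hv, hF1 v hv]
    by_cases hh : ∀ u, ¬ ℓ u w
    · by_cases ht : ∀ u, ¬ ℓ' v u
      · have h1 : c v + 1 = d := by omega
        rw [if_pos ⟨hh, ht⟩, if_pos hh, if_pos ht, h1, hF.eq _ _ (by omega)]
        simp only [s]
        split_ifs
        · ring
        · rw [hF.zero _ _ (by omega)]
          ring
      · simp [ht]
    · simp [hh]
  · intro v hv
    have hf : f w₀ = 0 := by simp [f, hc]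
    rw [Matrix.of_apply, hf, zero_mul, add_zero, hM]
    simp only [hℓ.agree_left hv, s]
    split_ifs
    · rw [hF.zero _ _ (by omega)]; ring
    · ring
    · ring
    · ring
  · intro v hv
    have hf : f w₀ = 0 := by simp [f, hc]
    rw [Matrix.of_apply, hf, zero_mul, add_zero, hM, hsv v hv, hF1 v hv]
    split_ifs <;> ring
  · intro w u v hu hw
    have hf : f w = 0 := by simp [f, hw]
    have hsw : s w = 1 := by simp [s, hw]
    rw [Matrix.of_apply, hf, zero_mul, add_zero]
    simp only [M, Matrix.of_apply, hsw, one_mul]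
    split_ifs with h
    · rw [linkMatrix_of_link _ _ h, hsv v (by have := hℓ.step' _ _ h; omega)]
      ring
    · rw [linkMatrix_of_pred _ _ hu h, mul_zero]

/-- Pivoting when level `d` has one element more than level `d - 1`. -/
lemma det_linkMatrix_pivot_head (hF : IsPivotPair d F F') (hℓ : LinksAgreeOff c d ℓ ℓ') {m : ℕ}
    (e : Fin (m + 1) ≃ {w // c w = d}) (e' : Fin m ≃ {v // c v = d - 1})
    (h : ∀ i j, ℓ (e' i) (e j) ↔ j = i.castSucc) (h' : ∀ i j, ℓ' (e' i) (e j) ↔ j = i.succ) :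
    (linkMatrix c F ℓ).det = (linkMatrix c F' ℓ').det := by
  have hlev : ∀ {u} {j}, ℓ u (e j) → ∃ i, (e' i : K) = u := by
    intro u j hu
    have h1 := hℓ.step _ _ hu
    have h2 := (e j).2
    obtain ⟨i, hi⟩ := e'.surjective ⟨u, by omega⟩
    exact ⟨i, by rw [hi]⟩
  have hlev' : ∀ {u} {j}, ℓ' u (e j) → ∃ i, (e' i : K) = u := by
    intro u j hu
    have h1 := hℓ.step' _ _ hu
    have h2 := (e j).2
    obtain ⟨i, hi⟩ := e'.surjective ⟨u, by omega⟩
    exact ⟨i, by rw [hi]⟩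
  have hlow : ∀ v, c v = d - 1 → ∃ i, (e' i : K) = v := fun v hv => by
    obtain ⟨i, hi⟩ := e'.surjective ⟨v, hv⟩
    exact ⟨i, by rw [hi]⟩
  obtain ⟨N, hdet, h1, h2, h3, h4, h5⟩ := exists_pivot_matrix hF hℓ (w₀ := e 0) (e 0).2 (by
    intro u hu
    obtain ⟨i, rfl⟩ := hlev' hu
    exact (Fin.succ_ne_zero i).symm ((h' _ _).1 hu))
  rw [← hdet]
  symm
  have hlast : ∀ u, ¬ ℓ u (e (Fin.last m)) := by
    intro u hu
    obtain ⟨i, rfl⟩ := hlev hu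
    exact (Fin.castSucc_lt_last i).ne' ((h _ _).1 hu)
  -- The head on level `d` is `e 0` for `ℓ'` and `e (Fin.last m)` for `ℓ`. Its row moves from the
  -- first place to the last, and the other rows move up by one, with `1` in place of `-1`.
  refine det_rotate e _ N ?_ ?_ ?_
  · intro w v hw
    by_cases hv : c v = d - 1
    · obtain ⟨i, rfl⟩ := hlow v hv
      rw [h2 _ _ hw hv, linkMatrix_of_succ c F ((h i _).2 rfl)]
      intro hl
      have := hℓ.step _ _ hl
      omega
    · exact h1 w v hw hv
  · intro v
    by_cases hv : c v = d - 1
    · obtain ⟨i, rfl⟩ := hlow v hv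
      rw [h4 _ hv, if_neg (fun hn => hn _ ((h' i _).2 rfl)),
        linkMatrix_of_succ c F ((h i _).2 rfl) (hlast _)]
    · rw [h3 _ hv]
      split_ifs with ht
      · rw [linkMatrix_of_head_of_tail c F hlast ht, (e _).2]
      · push Not at ht
        obtain ⟨u, hu⟩ := ht
        rw [linkMatrix_of_succ c F hu (hlast _)]
  · intro i v
    rw [h5 _ _ v ((h' i _).2 rfl) (e _).2]
    split_ifs with hv
    · obtain ⟨i', rfl⟩ := hlev' hv
      obtain rfl := Fin.succ_injective _ ((h' _ _).1 hv)
      rw [linkMatrix_of_link c F ((h _ _).2 rfl), neg_neg]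
    · rw [linkMatrix_of_pred c F ((h i _).2 rfl), neg_zero]
      intro hl
      obtain ⟨i', rfl⟩ := hlev hl
      obtain rfl := Fin.castSucc_injective _ ((h _ _).1 hl)
      exact hv ((h' _ _).2 rfl)

/-- Pivoting when level `d` has one element less than level `d - 1`. -/
lemma det_linkMatrix_pivot_tail (hF : IsPivotPair d F F') (hℓ : LinksAgreeOff c d ℓ ℓ') {m : ℕ}
    (e : Fin m ≃ {w // c w = d}) (e' : Fin (m + 1) ≃ {v // c v = d - 1})
    (h : ∀ i j, ℓ (e' i) (e j) ↔ i = j.succ) (h' : ∀ i j, ℓ' (e' i) (e j) ↔ i = j.castSucc) :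
    (linkMatrix c F ℓ).det = (linkMatrix c F' ℓ').det := by
  rw [← Matrix.det_transpose, ← Matrix.det_transpose (linkMatrix c F' ℓ'), linkMatrix_transpose,
    linkMatrix_transpose]
  -- Transposition makes level `d - 1` the upper one and swaps `castSucc` with `succ`, so the head
  -- case applies with `ℓ` and `ℓ'` exchanged.
  symm
  exact det_linkMatrix_pivot_head hF.transpose.symm hℓ.transpose.symm
    (e'.trans (Equiv.subtypeEquivRight fun v => by omega))
    (e.trans (Equiv.subtypeEquivRight fun v => by omega)) (fun i j => h' j i) (fun i j => h j i)

/-- Pivoting when `ℓ` is a bijection from level `d - 1` to level `d`. -/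
lemma det_linkMatrix_pivot_bijective (hF : IsPivotPair d F F') (hℓ : LinksAgreeOff c d ℓ ℓ')
    {m : ℕ} (e : Fin (m + 1) ≃ {w // c w = d}) (e' : Fin (m + 1) ≃ {v // c v = d - 1})
    (h : ∀ i j, ℓ (e' i) (e j) ↔ j = i)
    (h' : ∀ i j, ℓ' (e' i) (e j) ↔ (j : ℕ) = i + 1) :
    (linkMatrix c F ℓ).det = (linkMatrix c F' ℓ').det := by
  classical
  have hlev : ∀ {u} {j}, ℓ u (e j) → ∃ i, (e' i : K) = u := by
    intro u j hu
    have h1 := hℓ.step _ _ hu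
    have h2 := (e j).2
    obtain ⟨i, hi⟩ := e'.surjective ⟨u, by omega⟩
    exact ⟨i, by rw [hi]⟩
  have hlev' : ∀ {u} {j}, ℓ' u (e j) → ∃ i, (e' i : K) = u := by
    intro u j hu
    have h1 := hℓ.step' _ _ hu
    have h2 := (e j).2
    obtain ⟨i, hi⟩ := e'.surjective ⟨u, by omega⟩
    exact ⟨i, by rw [hi]⟩
  have hlow : ∀ v, c v = d - 1 → ∃ i, (e' i : K) = v := fun v hv => by
    obtain ⟨i, hi⟩ := e'.surjective ⟨v, hv⟩
    exact ⟨i, by rw [hi]⟩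
  have hup : ∀ {v} {u}, c v = d - 1 → ℓ' v u → ∃ j, (e j : K) = u := by
    intro v u hv hu
    have h1 := hℓ.step' _ _ hu
    obtain ⟨i, hi⟩ := e.surjective ⟨u, by omega⟩
    exact ⟨i, by rw [hi]⟩
  obtain ⟨N, hdet, h1, h2, h3, h4, h5⟩ := exists_pivot_matrix hF hℓ (w₀ := e 0) (e 0).2 (by
    intro u hu
    obtain ⟨i, rfl⟩ := hlev' hu
    have := (h' _ _).1 hu
    simp at this)
  set v₀ : K := (e' (Fin.last m) : K) with hv₀
  have htail : ∀ u, ¬ ℓ' v₀ u := by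
    intro u hu
    obtain ⟨j, rfl⟩ := hup (e' _).2 hu
    have h6 := (h' _ _).1 hu
    have h7 := j.2
    simp at h6
    omega
  -- The column of `v₀` has `-1` in the row of `w₀` and zeros elsewhere, so column operations with
  -- it clear the other entries of that row and change nothing else.
  let g : K → R := fun v => if c v ≠ d - 1 ∧ ∀ u, ¬ ℓ v u then F d (c v + 1) else 0
  have hg : (Matrix.of fun w v => N w v + g v * N w v₀).det = N.det := by
    rw [← Matrix.det_transpose, ← Matrix.det_transpose N]
    refine Matrix.det_eq_of_forall_row_eq_smul_add_const g v₀ ?_ fun _ _ => rfl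
    exact if_neg fun hn => hn.1 (e' (Fin.last m)).2
  rw [← hdet, ← hg]
  symm
  refine det_rotate e _ _ ?_ ?_ ?_
  · intro w v hw
    rw [Matrix.of_apply, h2 w v₀ hw (e' _).2, mul_zero, add_zero]
    by_cases hv : c v = d - 1
    · obtain ⟨i, rfl⟩ := hlow v hv
      rw [h2 _ _ hw hv, linkMatrix_of_succ c F ((h i _).2 rfl)]
      intro hl
      have := hℓ.step _ _ hl
      omega
    · exact h1 w v hw hv
  · intro v
    rw [Matrix.of_apply, h4 v₀ (e' _).2, if_pos htail]
    by_cases hv : c v = d - 1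
    · have hgv : g v = 0 := by simp [g, hv]
      rw [hgv, zero_mul, add_zero, h4 v hv]
      obtain ⟨i, rfl⟩ := hlow v hv
      obtain ⟨i, rfl⟩ | rfl := Fin.eq_castSucc_or_eq_last i
      · rw [if_neg (fun hn => hn (e i.succ) ((h' _ _).2 (by simp))),
          linkMatrix_of_succ c F ((h _ _).2 rfl)]
        intro hl
        exact (Fin.castSucc_lt_last i).ne' ((h _ _).1 hl)
      · rw [if_pos htail, linkMatrix_of_link c F ((h _ _).2 rfl)]
    · have hgv : g v = if (∀ u, ¬ ℓ v u) then F d (c v + 1) else 0 := by simp [g, hv]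
      rw [h3 v hv, ← hgv, linkMatrix_of_pred c F ((h (Fin.last m) _).2 rfl)]
      · ring
      · intro hl
        have := hℓ.step _ _ hl
        rw [(e _).2] at this
        omega
  · intro i v
    have h6 : ℓ' (e' i.castSucc) (e i.succ) := (h' _ _).2 (by simp)
    rw [Matrix.of_apply, h5 _ _ v h6 (e _).2, h5 _ _ v₀ h6 (e _).2, if_neg (htail _), mul_zero,
      add_zero]
    split_ifs with hv
    · obtain ⟨i', rfl⟩ := hlev' hv
      have h7 := (h' _ _).1 hv
      obtain rfl : i.castSucc = i' := Fin.ext (by simpa using h7)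
      rw [linkMatrix_of_link c F ((h _ _).2 rfl), neg_neg]
    · rw [linkMatrix_of_pred c F ((h i.castSucc _).2 rfl), neg_zero]
      intro hl
      obtain ⟨i', rfl⟩ := hlev hl
      obtain rfl := (h _ _).1 hl
      exact hv h6

end Flip

/-! ### Ribbon minors of a unitriangular array -/

section RibbonMinor

variable {R : Type*} [CommRing R]

/-- The minor of `H` with rows `x, d₁, …, d_r` and columns `d₁, …, d_r, y`, for a unitriangular
matrix `H` and `x < d₁ < … < d_r < y`. -/
def ribbonMinor (H : ℤ → ℤ → R) : ℤ → List ℤ → ℤ → R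
  | x, [], y => H x y
  | x, d :: L, y => H x d * ribbonMinor H d L y - ribbonMinor H x L y

/-- This is the product rule for ribbons: the product of the pieces on either side of `d` is the sum
of the two ways of joining them, with and without a break at `d`. -/
lemma ribbonMinor_append (H : ℤ → ℤ → R) (x : ℤ) (L₁ : List ℤ) (d : ℤ) (L₂ : List ℤ) (y : ℤ) :
    ribbonMinor H x (L₁ ++ d :: L₂) y =
      ribbonMinor H x L₁ d * ribbonMinor H d L₂ y - ribbonMinor H x (L₁ ++ L₂) y := by
  induction L₁ generalizing x with
  | nil => rfl
  | cons e L₁ ih =>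
    simp only [List.cons_append, ribbonMinor]
    rw [ih e, ih x]
    ring

/-- In the first column only the rows of `x` and `f 0` survive, with entries `H x (f 0)` and `1`.
Laplace expansion along it is the recursion of `ribbonMinor`. -/
lemma det_eq_ribbonMinor (H : ℤ → ℤ → R) (h1 : ∀ x, H x x = 1) (h0 : ∀ x y, y < x → H x y = 0)
    (n : ℕ) (x : ℤ) (f : ℕ → ℤ) (hf : ∀ i j, i < j → j ≤ n → f i < f j) :
    (Matrix.of fun i j : Fin (n + 1) =>
      H ((Fin.cases x (fun i : Fin n => f i) i : ℤ)) (f j)).det =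
        ribbonMinor H x (List.ofFn fun i : Fin n => f i) (f n) := by
  induction n generalizing x f with
  | zero => simp [ribbonMinor]
  | succ n ih =>
    have ihx := fun x => ih x (fun i => f (i + 1)) fun i j hij hj =>
      hf _ _ (by omega) (by omega)
    rw [Matrix.det_succ_column_zero, Fin.sum_univ_succ, Fin.sum_univ_succ, Finset.sum_eq_zero]
    · rw [List.ofFn_succ, ribbonMinor]
      have e1 := ihx (f 0)
      have e2 := ihx x
      refine Eq.trans ?_ (congrArg₂ (fun a b => H x (f 0) * a - b) e1 e2)
      rw [add_zero, sub_eq_add_neg]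
      congr 1
      · simp only [Fin.val_zero, pow_zero, one_mul, Matrix.of_apply, Fin.cases_zero]
        congr 2
        ext i j
        refine Fin.cases ?_ (fun i => ?_) i
        · simp
          rfl
        · simp
      · refine Eq.trans (congrArg₂ (fun a b => (-1 : R) ^ (0 + 1) * a * b) (h1 (f 0))
          (congrArg Matrix.det ?_))
          ((by intro b; simp : ∀ b : R, (-1) ^ (0 + 1) * 1 * b = -b) _)
        ext i j
        refine Fin.cases ?_ (fun i => ?_) i <;> simp
    · intro i _
      simp only [Matrix.of_apply, Fin.cases_succ]
      rw [h0 _ _ (hf _ _ _ _)]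
      · simp
      · simp
      · simp

/-- The elements of `D` strictly between `x` and `y`, in increasing order. -/
def breaks (D : Finset ℤ) (x y : ℤ) : List ℤ := (D.filter fun d => x < d ∧ d < y).sort

lemma eq_breaks {D : Finset ℤ} {x y : ℤ} {L : List ℤ} (hL : L.Pairwise (· < ·))
    (h : ∀ d, d ∈ L ↔ d ∈ D ∧ x < d ∧ d < y) : L = breaks D x y := by
  have : L.toFinset = D.filter fun d => x < d ∧ d < y := by
    ext d
    simp [h]
  rw [breaks, ← this]
  refine (List.toFinset_sort (r := (· ≤ ·)) (hL.imp ne_of_lt)).2 (hL.imp le_of_lt) |>.symm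

lemma breaks_pairwise (D : Finset ℤ) (x y : ℤ) : (breaks D x y).Pairwise (· < ·) :=
  (Finset.sortedLT_sort _).pairwise

lemma mem_breaks {D : Finset ℤ} {x y d : ℤ} : d ∈ breaks D x y ↔ d ∈ D ∧ x < d ∧ d < y := by
  simp [breaks]

/-- The minors `ribbonMinor` with the prescribed set `D` of possible breaks, extended by `1` for
empty ribbons and by `0` for undefined ones. -/
def ribbonEntry (H : ℤ → ℤ → R) (D : Finset ℤ) (x y : ℤ) : R :=
  if x = y then 1 else if y < x then 0 else ribbonMinor H x (breaks D x y) y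

lemma ribbonEntry_of_lt (H : ℤ → ℤ → R) (D : Finset ℤ) {x y : ℤ} (h : x < y) :
    ribbonEntry H D x y = ribbonMinor H x (breaks D x y) y := by
  rw [ribbonEntry, if_neg h.ne, if_neg h.not_gt]

lemma ribbonEntry_congr (H : ℤ → ℤ → R) {D D' : Finset ℤ} {x y : ℤ}
    (h : ∀ d, x < d → d < y → (d ∈ D ↔ d ∈ D')) : ribbonEntry H D x y = ribbonEntry H D' x y := by
  have : breaks D x y = breaks D' x y := by
    refine eq_breaks (breaks_pairwise _ _ _) fun d => ?_
    rw [mem_breaks]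
    exact and_congr_left fun hd => h d hd.1 hd.2
  rw [ribbonEntry, ribbonEntry, this]

lemma ribbonEntry_empty (H : ℤ → ℤ → R) (h1 : ∀ x, H x x = 1) (h0 : ∀ x y, y < x → H x y = 0) :
    ribbonEntry H ∅ = H := by
  ext x y
  rw [ribbonEntry]
  split_ifs with h h'
  · rw [h, h1]
  · rw [h0 _ _ h']
  · rw [← eq_breaks (L := []) (by simp) (by simp), ribbonMinor]

/-- The breaks between `x` and `y` are those before `d` followed by those after `d`, so the product
rule at `d` is the pivot relation. Unless `x < d < y`, adding `d` adds no break. -/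
lemma isPivotPair_ribbonEntry (H : ℤ → ℤ → R) {D : Finset ℤ} {d : ℤ} (hd : d ∉ D) :
    IsPivotPair d (ribbonEntry H D) (ribbonEntry H (insert d D)) where
  self := if_pos rfl
  zero x y h := by rw [ribbonEntry, if_neg h.ne', if_pos h]
  pivot x y hx hy := by
    rw [ribbonEntry_of_lt H _ hx, ribbonEntry_of_lt H _ hy, ribbonEntry_of_lt H _ (hx.trans hy),
      ribbonEntry_of_lt H _ (hx.trans hy)]
    have e1 : breaks D x d ++ d :: breaks D d y = breaks (insert d D) x y := by
      apply eq_breaks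
      · rw [List.pairwise_append, List.pairwise_cons]
        refine ⟨breaks_pairwise _ _ _, ⟨?_, breaks_pairwise _ _ _⟩, ?_⟩
        · intro e he
          exact (mem_breaks.1 he).2.1
        · intro e he f hf
          have h1 := (mem_breaks.1 he).2.2
          rcases List.mem_cons.1 hf with rfl | hf
          · exact h1
          · exact h1.trans (mem_breaks.1 hf).2.1
      · intro e
        simp only [List.mem_append, List.mem_cons, mem_breaks, mem_insert]
        constructor
        · rintro (⟨h1, h2, h3⟩ | rfl | ⟨h1, h2, h3⟩)
          · exact ⟨Or.inr h1, h2, h3.trans hy⟩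
          · exact ⟨Or.inl rfl, hx, hy⟩
          · exact ⟨Or.inr h1, hx.trans h2, h3⟩
        · rintro ⟨rfl | h1, h2, h3⟩
          · exact Or.inr (Or.inl rfl)
          · rcases lt_trichotomy e d with h4 | rfl | h4
            · exact Or.inl ⟨h1, h2, h4⟩
            · exact absurd h1 hd
            · exact Or.inr (Or.inr ⟨h1, h4, h3⟩)
    have e2 : breaks D x d ++ breaks D d y = breaks D x y := by
      apply eq_breaks
      · rw [List.pairwise_append]
        refine ⟨breaks_pairwise _ _ _, breaks_pairwise _ _ _, ?_⟩
        intro e he f hf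
        exact (mem_breaks.1 he).2.2.trans (mem_breaks.1 hf).2.1
      · intro e
        simp only [List.mem_append, mem_breaks]
        constructor
        · rintro (⟨h1, h2, h3⟩ | ⟨h1, h2, h3⟩)
          · exact ⟨h1, h2, h3.trans hy⟩
          · exact ⟨h1, hx.trans h2, h3⟩
        · rintro ⟨h1, h2, h3⟩
          rcases lt_trichotomy e d with h4 | rfl | h4
          · exact Or.inl ⟨h1, h2, h4⟩
          · exact absurd h1 hd
          · exact Or.inr ⟨h1, h4, h3⟩
    rw [← e1, ← e2, ribbonMinor_append]
  eq x y h := by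
    refine ribbonEntry_congr H fun e h1 h2 => ?_
    rw [mem_insert, or_iff_right]
    rintro rfl
    exact h ⟨h1, h2⟩

end RibbonMinor

/-! ### Tops and bottoms of columns -/

namespace RShape

variable (S : RShape)

lemma mem_cells {S : RShape} {i j : ℕ} :
    (i, j) ∈ S.cells ↔ S.inner.colLen j ≤ i ∧ i < S.outer.colLen j := by
  rw [cells, mem_sdiff, YoungDiagram.mem_cells, YoungDiagram.mem_cells,
    YoungDiagram.mem_iff_lt_colLen, YoungDiagram.mem_iff_lt_colLen]
  omega

lemma outer_colLen_eq {S : RShape} {i j : ℕ} (h : (i, j) ∈ S.cells) (h' : (i + 1, j) ∉ S.cells) :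
    S.outer.colLen j = i + 1 := by
  rw [mem_cells] at h h'
  omega

lemma inner_colLen_eq {S : RShape} {i j : ℕ} (h : (i, j) ∈ S.cells)
    (h' : i = 0 ∨ (i - 1, j) ∉ S.cells) : S.inner.colLen j = i := by
  rw [mem_cells] at h h'
  omega

lemma bottomContent_eq {S : RShape} {i j : ℕ} (h : (i, j) ∈ S.cells) (h' : (i + 1, j) ∉ S.cells) :
    S.bottomContent j = S.content (i, j) := by
  rw [bottomContent, content, outer_colLen_eq h h']
  simp

lemma topContent_eq {S : RShape} {i j : ℕ} (h : (i, j) ∈ S.cells)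
    (h' : i = 0 ∨ (i - 1, j) ∉ S.cells) : S.topContent j = S.content (i, j) := by
  rw [topContent, content, inner_colLen_eq h h']

end RShape

/-! ### Columns of a strip and its determinant -/

section Strip

variable (up : ℤ → Prop) [DecidablePred up] {p q : ℤ}

lemma stripRow_succ {c : ℤ} (h : c < q) :
    stripRow up q c = stripRow up q (c + 1) + if up c then 1 else 0 := by
  rw [stripRow, stripRow, ← Finset.insert_Ico_add_one_left_eq_Ico h, Finset.filter_insert]
  split_ifs
  · rw [card_insert_of_notMem (by simp)]
  · rfl

lemma stripCol_succ {c : ℤ} (h : p ≤ c) :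
    stripCol up p (c + 1) = stripCol up p c + if up c then 0 else 1 := by
  rw [stripCol, stripCol, ← Finset.insert_Ico_right_eq_Ico_add_one h, Finset.filter_insert]
  split_ifs <;> simp

lemma mem_stripCells {x : ℕ × ℕ} :
    x ∈ stripCells up p q ↔ ∃ c, p ≤ c ∧ c ≤ q ∧ x = (stripRow up q c, stripCol up p c) := by
  simp only [stripCells, mem_image, mem_Icc, and_assoc, eq_comm]

lemma stripCell_below_notMem {c : ℤ} (h₁ : p ≤ c) (h₂ : c ≤ q) (h : c = p ∨ ¬ up (c - 1)) :
    (stripRow up q c + 1, stripCol up p c) ∉ stripCells up p q := by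
  rw [mem_stripCells]
  rintro ⟨e, he1, he2, he⟩
  rw [Prod.mk.injEq] at he
  have h3 := stripCol_sub_stripRow up p q h₁ h₂
  have h4 := stripCol_sub_stripRow up p q he1 he2
  obtain rfl : e = c - 1 := by omega
  have h5 := stripRow_succ up (c := c - 1) (q := q) (by omega)
  rw [if_neg (h.resolve_left (by omega)), sub_add_cancel] at h5
  omega

lemma stripCell_above_notMem {c : ℤ} (h₁ : p ≤ c) (h₂ : c ≤ q) (h : c = q ∨ ¬ up c) :
    stripRow up q c = 0 ∨ (stripRow up q c - 1, stripCol up p c) ∉ stripCells up p q := by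
  rw [or_iff_not_imp_left, mem_stripCells]
  rintro h0 ⟨e, he1, he2, he⟩
  rw [Prod.mk.injEq] at he
  have h3 := stripCol_sub_stripRow up p q h₁ h₂
  have h4 := stripCol_sub_stripRow up p q he1 he2
  obtain rfl : e = c + 1 := by omega
  have h5 := stripRow_succ up (c := c) (q := q) (by omega)
  rw [if_neg (h.resolve_left (by omega))] at h5
  omega

lemma stripShape_content {c : ℤ} (h₁ : p ≤ c) (h₂ : c ≤ q) :
    (stripShape up p q).content (stripRow up q c, stripCol up p c) = c := by
  have h0 : stripCol up p p = 0 := by simp [stripCol]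
  have h3 : (stripShape up p q).outer.colLen 0 = stripRow up q p + 1 := by
    rw [← h0]
    refine RShape.outer_colLen_eq ?_ ?_ <;> rw [stripShape_cells]
    · exact (mem_stripCells up).2 ⟨p, le_rfl, h₁.trans h₂, rfl⟩
    · exact stripCell_below_notMem up le_rfl (h₁.trans h₂) (Or.inl rfl)
  have h4 := stripCol_sub_stripRow up p q h₁ h₂
  have h5 : (stripShape up p q).root = p := rfl
  rw [RShape.content, RShape.shiftedContent, h3, h5]
  push_cast
  omega

lemma stripShape_bottomContent {c : ℤ} (h₁ : p ≤ c) (h₂ : c ≤ q) (h : c = p ∨ ¬ up (c - 1)) :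
    (stripShape up p q).bottomContent (stripCol up p c) = c := by
  rw [RShape.bottomContent_eq (i := stripRow up q c), stripShape_content up h₁ h₂] <;>
    rw [stripShape_cells]
  · exact (mem_stripCells up).2 ⟨c, h₁, h₂, rfl⟩
  · exact stripCell_below_notMem up h₁ h₂ h

lemma stripShape_topContent {c : ℤ} (h₁ : p ≤ c) (h₂ : c ≤ q) (h : c = q ∨ ¬ up c) :
    (stripShape up p q).topContent (stripCol up p c) = c := by
  rw [RShape.topContent_eq (i := stripRow up q c), stripShape_content up h₁ h₂] <;>
    rw [stripShape_cells]
  · exact (mem_stripCells up).2 ⟨c, h₁, h₂, rfl⟩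
  · exact stripCell_above_notMem up h₁ h₂ h

lemma stripShape_numCols (h : p ≤ q) : (stripShape up p q).numCols = stripCol up p q + 1 := by
  have h0 : stripRow up q q = 0 := by simp [stripRow]
  have h1 : (0, stripCol up p q) ∈ (stripShape up p q).outer := by
    rw [← h0]
    refine Finset.mem_biUnion.2 ⟨_, (mem_stripCells up).2 ⟨q, h, le_rfl, rfl⟩, ?_⟩
    simp
  have h2 : (0, stripCol up p q + 1) ∉ (stripShape up p q).outer := by
    intro hx
    obtain ⟨s, hs, hxs⟩ := Finset.mem_biUnion.1 hx
    obtain ⟨c, hc1, hc2, rfl⟩ := (mem_stripCells up).1 hs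
    have h3 := stripCol_mono up p hc2
    have h4 := (Finset.mem_Iic.1 hxs).2
    dsimp only at h4
    omega
  rw [YoungDiagram.mem_iff_lt_rowLen] at h1 h2
  rw [RShape.numCols]
  omega

lemma exists_stripCol_eq {c : ℤ} (h : p ≤ c) {s : ℕ} (hs : s < stripCol up p c) :
    ∃ e, p ≤ e ∧ e < c ∧ ¬ up e ∧ stripCol up p e = s := by
  induction c, h using Int.leInduction with
  | base => simp [stripCol] at hs
  | succ c hc ih =>
    rw [stripCol_succ up hc] at hs
    rcases lt_or_ge s (stripCol up p c) with h | h
    · obtain ⟨e, h1, h2, h3⟩ := ih h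
      exact ⟨e, h1, by omega, h3⟩
    · split_ifs at hs with hu
      · omega
      · exact ⟨c, hc, by omega, hu, by omega⟩

/-- The columns of a ribbon use up consecutive contents: each column starts one above the top
content of the previous one. So the row indices are `p` and the breaks, and the column indices are
the same breaks and `q + 1`. -/
lemma stripShape_det {R : Type*} [CommRing R] (H : ℤ → ℤ → R) (h1 : ∀ x, H x x = 1)
    (h0 : ∀ x y, y < x → H x y = 0) (D : Finset ℤ) (hpq : p ≤ q)
    (hD : ∀ d, p < d → d ≤ q → (d ∈ D ↔ ¬ up (d - 1))) :
    (Matrix.of fun i j : Fin (stripShape up p q).numCols =>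
      H ((stripShape up p q).bottomContent i) ((stripShape up p q).topContent j + 1)).det =
        ribbonEntry H D p (q + 1) := by
  set T := stripShape up p q
  set n := stripCol up p q with hn
  have hex : ∀ s, s < n → ∃ e, p ≤ e ∧ e < q ∧ ¬ up e ∧ stripCol up p e = s := fun s hs =>
    exists_stripCol_eq up hpq hs
  have htop : ∀ e, p ≤ e → e < q → ¬ up e → T.topContent (stripCol up p e) = e :=
    fun e he1 he2 he => stripShape_topContent up he1 he2.le (Or.inr he)
  have htopn : T.topContent n = q := stripShape_topContent up hpq le_rfl (Or.inl rfl)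
  have hbot0 : T.bottomContent 0 = p := by
    have := stripShape_bottomContent up le_rfl hpq (Or.inl rfl)
    rwa [show stripCol up p p = 0 by simp [stripCol]] at this
  have hbot : ∀ s, s < n → T.bottomContent (s + 1) = T.topContent s + 1 := by
    intro s hs
    obtain ⟨e, he1, he2, he3, rfl⟩ := hex s hs
    rw [htop e he1 he2 he3]
    have h2 := stripShape_bottomContent up (p := p) (q := q) (c := e + 1) (by omega) (by omega)
      (Or.inr (by simpa using he3))
    rwa [stripCol_succ up he1, if_neg he3] at h2
  have hmono : ∀ i j, i < j → j ≤ n → T.topContent i + 1 < T.topContent j + 1 := by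
    intro i j hij hj
    obtain ⟨e, he1, he2, he3, rfl⟩ := hex i (by omega)
    rw [htop e he1 he2 he3]
    rcases hj.lt_or_eq with hj | rfl
    · obtain ⟨e', he1', he2', he3', rfl⟩ := hex j hj
      rw [htop e' he1' he2' he3']
      by_contra hlt
      have := stripCol_mono up p (show e' ≤ e by omega)
      omega
    · rw [htopn]
      omega
  have hL : (List.ofFn fun i : Fin n => T.topContent i + 1) = breaks D p (q + 1) := by
    apply eq_breaks
    · rw [List.pairwise_ofFn]
      intro i j hij
      exact hmono i j hij j.2.le
    · intro d
      rw [List.mem_ofFn]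
      constructor
      · rintro ⟨i, rfl⟩
        obtain ⟨e, he1, he2, he3, he⟩ := hex i i.2
        rw [← he, htop e he1 he2 he3, hD _ (by omega) (by omega)]
        refine ⟨by simpa using he3, by omega, by omega⟩
      · rintro ⟨h2, h3, h4⟩
        have h5 := (hD d h3 (by omega)).1 h2
        have h6 := stripCol_succ up (p := p) (c := d - 1) (by omega)
        rw [if_neg h5, sub_add_cancel] at h6
        have h7 := stripCol_mono up p (show d ≤ q by omega)
        refine ⟨⟨stripCol up p (d - 1), by omega⟩, ?_⟩
        dsimp only
        rw [htop _ (by omega) (by omega) h5]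
        ring
  have hdet := det_eq_ribbonMinor H h1 h0 n p (fun i => T.topContent i + 1) hmono
  rw [ribbonEntry_of_lt H D (by omega), ← hL]
  simp only [htopn] at hdet
  rw [← hdet]
  have hN : n + 1 = T.numCols := (stripShape_numCols up hpq).symm
  rw [← Matrix.det_submatrix_equiv_self (finCongr hN)]
  congr 1
  ext i j
  simp only [Matrix.submatrix_apply, Matrix.of_apply, finCongr_apply, Fin.val_cast]
  congr 1
  refine Fin.cases ?_ (fun i => ?_) i
  · simpa using hbot0
  · simpa using hbot i i.2

end Strip

/-! ### Column functions, and the left side as the determinant of upward links -/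

lemma superE_of_neg {R : Type*} [CommRing R] (y z : ℤ → R) (a b a' b' : ℤ) {m : ℤ} (h : m < 0) :
    superE y z a b a' b' m = 0 := if_pos h

lemma superE_zero {R : Type*} [CommRing R] (y z : ℤ → R) (a b a' b' : ℤ) :
    superE y z a b a' b' 0 = 1 := by
  have h : ((∅ : Sym ℤ 0) : Multiset ℤ) = 0 := rfl
  simp [superE, esymmInterval, hsymmInterval, h]

/-- A discrete intermediate value principle, applied to contents and column numbers, which change by
at most one between adjacent cells. -/
lemma exists_step_of_reflTransGen {α : Type*} {r : α → α → Prop} {x y : α}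
    (h : Relation.ReflTransGen r x y) (P : α → Prop) (hx : P x) (hy : ¬ P y) :
    ∃ u v, r u v ∧ P u ∧ ¬ P v := by
  induction h with
  | refl => exact absurd hx hy
  | @tail u v _ huv ih =>
    by_cases hu : P u
    · exact ⟨u, v, huv, hu, hy⟩
    · exact ih hu

namespace RShape

variable (S : RShape)

lemma leftmostCell_spec {c : ℤ} {x : ℕ × ℕ} (hx : x ∈ S.cells) (hc : S.content x = c) :
    S.leftmostCell c ∈ S.cells ∧ S.content (S.leftmostCell c) = c ∧ (S.leftmostCell c).2 ≤ x.2 := by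
  have h : ({x ∈ S.cells | S.content x = c}).Nonempty := ⟨x, mem_filter.2 ⟨hx, hc⟩⟩
  rw [leftmostCell, dif_pos h]
  have h1 := (Finset.exists_min_image _ Prod.snd h).choose_spec
  have h2 := mem_filter.1 h1.1
  exact ⟨h2.1, h2.2, h1.2 x (mem_filter.2 ⟨hx, hc⟩)⟩

lemma rightmostCell_spec {c : ℤ} {x : ℕ × ℕ} (hx : x ∈ S.cells) (hc : S.content x = c) :
    S.rightmostCell c ∈ S.cells ∧ S.content (S.rightmostCell c) = c ∧
      x.2 ≤ (S.rightmostCell c).2 := by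
  have h : ({x ∈ S.cells | S.content x = c}).Nonempty := ⟨x, mem_filter.2 ⟨hx, hc⟩⟩
  rw [rightmostCell, dif_pos h]
  have h1 := (Finset.exists_max_image _ Prod.snd h).choose_spec
  have h2 := mem_filter.1 h1.1
  exact ⟨h2.1, h2.2, h1.2 x (mem_filter.2 ⟨hx, hc⟩)⟩

/-- A cell of the same content further left would lie higher, whereas the columns further left begin
no higher. Consequently the content flag at the top of a column is the original flag. -/
lemma leftmostCell_topContent {j : ℕ} (h : S.inner.colLen j < S.outer.colLen j) :
    S.leftmostCell (S.topContent j) = (S.inner.colLen j, j) := by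
  obtain ⟨h1, h2, h3⟩ := S.leftmostCell_spec (c := S.topContent j) (x := (S.inner.colLen j, j))
    (mem_cells.2 ⟨le_rfl, h⟩) rfl
  generalize S.leftmostCell (S.topContent j) = m at *
  obtain ⟨i', j'⟩ := m
  dsimp only at h3
  rw [mem_cells] at h1
  have h4 := S.inner.colLen_anti j' j h3
  simp only [content, topContent, shiftedContent] at h2 h3
  rw [Prod.mk.injEq]
  omega

lemma rightmostCell_bottomContent {j : ℕ} (h : S.inner.colLen j < S.outer.colLen j) :
    S.rightmostCell (S.bottomContent j) = (S.outer.colLen j - 1, j) := by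
  obtain ⟨h1, h2, h3⟩ := S.rightmostCell_spec (c := S.bottomContent j)
    (x := (S.outer.colLen j - 1, j)) (mem_cells.2 (by omega))
    (by simp only [content, bottomContent, shiftedContent]; omega)
  generalize S.rightmostCell (S.bottomContent j) = m at *
  obtain ⟨i', j'⟩ := m
  dsimp only at h3
  rw [mem_cells] at h1
  have h4 := S.outer.colLen_anti j j' h3
  simp only [content, bottomContent, shiftedContent] at h2 h3
  rw [Prod.mk.injEq]
  omega

/-- The flag `a`, moved along the column to the leftmost cell of content `c`. -/
noncomputable def contentFlagA (a : ℕ → ℤ) (c : ℤ) : ℤ :=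
  a (S.leftmostCell c).2 - ((S.inner.colLen (S.leftmostCell c).2 : ℤ) + 1) +
    (((S.leftmostCell c).1 : ℤ) + 1)

/-- The flag `b`, moved along the column to the rightmost cell of content `c`. -/
noncomputable def contentFlagB (b : ℕ → ℤ) (c : ℤ) : ℤ :=
  b (S.rightmostCell c).2 - (S.outer.colLen (S.rightmostCell c).2 : ℤ) +
    (((S.rightmostCell c).1 : ℤ) + 1)

/-- The flagged supersymmetric function of a column whose bottom cell has content `x` and whose top
cell has content `t - 1`. -/
noncomputable def columnFunction {R : Type*} [CommRing R] (a b : ℕ → ℤ) (y z : ℤ → R) (x t : ℤ) :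
    R :=
  superE y z (S.contentFlagA a (t - 1)) (S.contentFlagB b x) (S.contentFlagA a (t - 1) + (t - 1))
    (S.contentFlagB b x + x) (t - x)

section ColumnFunction

variable {R : Type*} [CommRing R] (a b : ℕ → ℤ) (y z : ℤ → R)

lemma columnFunction_self (x : ℤ) : S.columnFunction a b y z x x = 1 := by
  rw [columnFunction, sub_self, superE_zero]

lemma columnFunction_of_lt (x t : ℤ) (h : t < x) : S.columnFunction a b y z x t = 0 := by
  rw [columnFunction, superE_of_neg]
  omega

/-- In the direction of content `c` to content `c + 1`, the cell `w` follows the cell `v`: it is its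
right neighbour if `c + 1 ∈ D`, and its upper neighbour otherwise. -/
def Link (D : Finset ℤ) (v w : S.cells) : Prop :=
  if S.content w ∈ D then v.1.1 = w.1.1 ∧ w.1.2 = v.1.2 + 1
  else v.1.1 = w.1.1 + 1 ∧ v.1.2 = w.1.2

variable {S}

lemma Link.content_eq {D : Finset ℤ} {v w : S.cells} (h : S.Link D v w) :
    S.content w = S.content v + 1 := by
  rw [Link] at h
  simp only [content, shiftedContent]
  split_ifs at h <;> omega

open Classical in
/-- The block of a column: `1` for a nonempty column, `0` for an empty one to the left of a nonempty
one, `2` for the remaining ones. -/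
noncomputable def columnBlock (S : RShape) (j : ℕ) : Fin 3 :=
  if S.inner.colLen j < S.outer.colLen j then 1
  else if ∃ j', j < j' ∧ S.inner.colLen j' < S.outer.colLen j' then 0 else 2

lemma columnBlock_eq_one {j : ℕ} :
    S.columnBlock j = 1 ↔ S.inner.colLen j < S.outer.colLen j := by
  rw [columnBlock]
  split_ifs <;> simp_all

/-- By connectedness the nonempty columns are consecutive, so the three blocks occur from left to
right. -/
lemma columnBlock_lt (hS : CellsConnected S.cells) {i j : ℕ}
    (h : S.columnBlock j < S.columnBlock i) : j < i ∧
      (S.outer.colLen i ≤ S.inner.colLen i ∨ S.outer.colLen j ≤ S.inner.colLen j) := by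
  rw [columnBlock, columnBlock] at h
  have key : ∀ i j j', i < j → j < j' → S.inner.colLen i < S.outer.colLen i →
      S.inner.colLen j' < S.outer.colLen j' → S.inner.colLen j < S.outer.colLen j := by
    intro i j j' hij hjj' hi hj'
    obtain ⟨⟨u1, u2⟩, ⟨v1, v2⟩, ⟨hu, hv, huv⟩, h1, h2⟩ := exists_step_of_reflTransGen
      (hS.2 (S.inner.colLen i, i) (mem_cells.2 ⟨le_rfl, hi⟩) (S.inner.colLen j', j')
        (mem_cells.2 ⟨le_rfl, hj'⟩)) (fun x => x.2 < j) hij (by dsimp only; omega)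
    dsimp only at h1 h2
    rw [CellAdj] at huv
    dsimp only at huv
    obtain rfl : v2 = j := by omega
    rw [mem_cells] at hv
    omega
  by_cases hi : S.inner.colLen i < S.outer.colLen i
  · by_cases hj : S.inner.colLen j < S.outer.colLen j
    · rw [if_pos hi, if_pos hj] at h
      exact absurd h (by decide)
    · rw [if_pos hi, if_neg hj] at h
      refine ⟨?_, Or.inr (not_lt.1 hj)⟩
      split_ifs at h with hex
      · obtain ⟨j', hjj', hj'⟩ := hex
        by_contra hij
        rcases (not_lt.1 hij).lt_or_eq with hlt | rfl
        · exact hj (key i j j' hlt hjj' hi hj')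
        · exact hj hi
      · exact absurd h (by decide)
  · refine ⟨?_, Or.inl (not_lt.1 hi)⟩
    rw [if_neg hi] at h
    by_cases hex : ∃ j', i < j' ∧ S.inner.colLen j' < S.outer.colLen j'
    · rw [if_pos hex] at h
      exact absurd h (Fin.not_lt_zero _)
    · by_contra hij
      rcases (not_lt.1 hij).lt_or_eq with hlt | rfl
      · have hex' : ¬ ∃ j', j < j' ∧ S.inner.colLen j' < S.outer.colLen j' :=
          fun ⟨j', h1, h2⟩ => hex ⟨j', hlt.trans h1, h2⟩
        rw [if_neg fun hj => hex ⟨j, hlt, hj⟩, if_neg hex', if_neg hex] at h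
        exact absurd h (lt_irrefl _)
      · rw [if_neg hi] at h
        exact absurd h (lt_irrefl _)

/-- An empty column has diagonal entry `e_0 = 1`, and the entries below the diagonal in its row or
column have negative degree. Such columns therefore split off as unitriangular blocks, and the
nonempty columns are the chains of upward links. -/
lemma flaggedSchur_eq_det_link (hS : CellsConnected S.cells) {n : ℕ} (hn : S.numCols ≤ n) :
    S.flaggedSchur n a b y z =
      (linkMatrix (fun w : S.cells => S.content w) (S.columnFunction a b y z) (S.Link ∅)).det := by
  set M : Matrix (Fin n) (Fin n) R := Matrix.of fun i j =>
    superE y z (a j) (b i) (a j + S.topContent j) (b i + S.bottomContent i)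
      ((S.outer.colLen i : ℤ) - i - S.inner.colLen j + j) with hM
  change M.det = _
  have hzero : ∀ i j : Fin n, j < i →
      (S.outer.colLen i ≤ S.inner.colLen i ∨ S.outer.colLen j ≤ S.inner.colLen j) →
        M i j = 0 := by
    intro i j hij h
    have h1 := S.outer.colLen_anti j i hij.le
    have h2 := S.inner.colLen_anti j i hij.le
    have h3 : (j : ℕ) < i := hij
    exact superE_of_neg _ _ _ _ _ _ (by omega)
  have hempty : ∀ k : Fin 3, k ≠ 1 →
      (M.toSquareBlock (fun j : Fin n => S.columnBlock j) k).det = 1 := by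
    intro k hk
    have hj : ∀ j : {j : Fin n // S.columnBlock j = k},
        S.outer.colLen j.1 ≤ S.inner.colLen j.1 := by
      intro j
      rw [← not_lt, ← columnBlock_eq_one, j.2]
      exact hk
    rw [Matrix.det_of_isUpperTriangular]
    · refine Finset.prod_eq_one fun j _ => ?_
      have h1 : S.inner.colLen j.1 ≤ S.outer.colLen j.1 := by
        by_contra h
        push Not at h
        have h2 := YoungDiagram.mem_iff_lt_colLen.2 h
        exact lt_irrefl _ (YoungDiagram.mem_iff_lt_colLen.1 (S.inner_le h2))
      have h2 := hj j
      have h3 : ((S.outer.colLen j.1 : ℤ) - (j.1 : ℕ) - S.inner.colLen j.1 + (j.1 : ℕ)) = 0 := by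
        omega
      rw [Matrix.toSquareBlock_def, Matrix.of_apply, hM, Matrix.of_apply, h3, superE_zero]
    · intro i j hij
      exact hzero i j hij (Or.inl (hj i))
  have hblock : M.BlockTriangular (fun j : Fin n => S.columnBlock j) := by
    intro i j hij
    obtain ⟨h1, h2⟩ := columnBlock_lt hS hij
    exact hzero i j h1 h2
  rw [hblock.det_fintype, Fin.prod_univ_three, hempty 0 (by decide), hempty 2 (by decide), one_mul,
    mul_one]
  have hcol : ∀ j : {j : Fin n // S.columnBlock j = 1}, S.inner.colLen j.1 < S.outer.colLen j.1 :=
    fun j => columnBlock_eq_one.1 j.2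
  have hlt : ∀ w : S.cells, w.1.2 < n := by
    rintro ⟨⟨i, j⟩, h⟩
    refine lt_of_lt_of_le ?_ hn
    rw [numCols, ← YoungDiagram.mem_iff_lt_rowLen, YoungDiagram.mem_iff_lt_colLen]
    rw [mem_cells] at h
    dsimp only
    omega
  symm
  rw [det_linkMatrix_eq_det_chains (ι := {j : Fin n // S.columnBlock j = 1}) _ _ _
    (fun w => ⟨⟨w.1.2, hlt w⟩, columnBlock_eq_one.2 (by
      have := mem_cells.1 w.2
      exact this.1.trans_lt this.2)⟩) (fun j => S.bottomContent j.1) (fun j => S.topContent j.1)]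
  · congr 1
    ext i j
    rw [Matrix.of_apply, Matrix.toSquareBlock_def, Matrix.of_apply, hM, Matrix.of_apply,
      columnFunction, contentFlagA, contentFlagB, add_sub_cancel_right,
      leftmostCell_topContent S (hcol j), rightmostCell_bottomContent S (hcol i)]
    have h1 := hcol i
    congr 1
    · ring
    · dsimp only; omega
    · ring
    · dsimp only; omega
    · simp only [topContent, bottomContent, shiftedContent]
      ring
  · intro j
    have := hcol j
    simp only [topContent, bottomContent, shiftedContent]
    omega
  · rintro ⟨⟨i, j⟩, h⟩
    rw [mem_cells] at h
    simp only [topContent, bottomContent, content, shiftedContent]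
    omega
  · intro j x h1 h2
    simp only [topContent, bottomContent, shiftedContent] at h1 h2
    refine ⟨⟨(((j.1 : ℕ) + S.root - 1 + S.outer.colLen 0 - x).toNat, j.1),
      mem_cells.2 (by omega)⟩, rfl, ?_⟩
    simp only [content, shiftedContent]
    omega
  · rintro ⟨⟨i, j⟩, h⟩ ⟨⟨i', j'⟩, h'⟩ h1 h2
    simp only [Subtype.mk.injEq, Fin.mk.injEq] at h1
    simp only [content, shiftedContent] at h2
    simp only [Subtype.mk.injEq, Prod.mk.injEq]
    omega
  · rintro ⟨⟨i, j⟩, h⟩ ⟨⟨i', j'⟩, h'⟩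
    simp only [Link, notMem_empty, if_false, Subtype.mk.injEq, Fin.mk.injEq, content,
      shiftedContent]
    omega

end ColumnFunction

end RShape

/-! ### Interlacing diagonals and the change of direction of one diagonal -/

namespace RShape

variable {S : RShape}

lemma mem_cells_of_le {i j i₁ j₁ i₂ j₂ : ℕ} (h₁ : (i₁, j₁) ∈ S.cells) (h₂ : (i₂, j₂) ∈ S.cells)
    (hi₁ : i₁ ≤ i) (hj₁ : j₁ ≤ j) (hi₂ : i ≤ i₂) (hj₂ : j ≤ j₂) : (i, j) ∈ S.cells := by
  rw [mem_cells] at *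
  have h3 := S.inner.colLen_anti j₁ j hj₁
  have h4 := S.outer.colLen_anti j j₂ hj₂
  omega

lemma content_mk (i j : ℕ) : S.content (i, j) = j - i + S.root - 1 + S.outer.colLen 0 := rfl

/-- Skew shapes are convex, so the cells of a diagonal occupy consecutive rows `α, …, α + m`. -/
lemma exists_diagonal_equiv {c : ℤ} (h : ∃ x ∈ S.cells, S.content x = c) :
    ∃ (α m : ℕ) (e : Fin (m + 1) ≃ {w : S.cells // S.content w = c}),
      ∀ k, (e k).1.1.1 = α + k := by
  set A : Finset ℕ := {x ∈ S.cells | S.content x = c}.image Prod.fst with hA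
  have hne : A.Nonempty := by
    obtain ⟨x, hx, hc⟩ := h
    exact ⟨x.1, mem_image_of_mem _ (mem_filter.2 ⟨hx, hc⟩)⟩
  have hmem : ∀ i, i ∈ A ↔ ∃ j, (i, j) ∈ S.cells ∧ S.content (i, j) = c := by
    intro i
    simp [hA]
  have hαβ := A.min'_le _ (A.max'_mem hne)
  obtain ⟨j₁, h1, h1'⟩ := (hmem _).1 (A.min'_mem hne)
  obtain ⟨j₂, h2, h2'⟩ := (hmem _).1 (A.max'_mem hne)
  have hlo := A.min'_le
  have hhi := A.le_max'
  set α := A.min' hne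
  set β := A.max' hne
  rw [content_mk] at h1' h2'
  have hex : ∀ k : Fin (β - α + 1), ∃ w : {w : S.cells // S.content w = c}, w.1.1.1 = α + k := by
    intro k
    have hk := k.2
    refine ⟨⟨⟨(α + k, j₁ + k), mem_cells_of_le h1 h2 ?_ ?_ ?_ ?_⟩, ?_⟩, rfl⟩
    · omega
    · omega
    · omega
    · omega
    · rw [content_mk]
      push_cast
      omega
  choose f hf using hex
  have hbij : Function.Bijective f := by
    constructor
    · intro k l hkl
      have h3 := hf k
      rw [hkl, hf] at h3
      exact Fin.ext (by omega)
    · rintro ⟨⟨⟨i, j⟩, hij⟩, hc⟩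
      have hi : i ∈ A := (hmem i).2 ⟨j, hij, hc⟩
      have h3 := hlo i hi
      have h4 := hhi i hi
      refine ⟨⟨i - α, by omega⟩, ?_⟩
      have h5 := hf ⟨i - α, by omega⟩
      generalize f ⟨i - α, by omega⟩ = w at h5
      obtain ⟨⟨⟨i', j'⟩, hij'⟩, hc'⟩ := w
      dsimp only at h5
      have h6 := hc
      have h7 := hc'
      rw [content_mk] at h6 h7
      refine Subtype.ext (Subtype.ext (Prod.ext ?_ ?_)) <;> dsimp only <;> omega
  exact ⟨α, β - α, Equiv.ofBijective f hbij, hf⟩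

lemma exists_mem_cells_of_diagonal_equiv {c : ℤ} {α m : ℕ}
    (e : Fin (m + 1) ≃ {w : S.cells // S.content w = c}) (he : ∀ k, (e k).1.1.1 = α + k) {t : ℕ}
    (h₁ : α ≤ t) (h₂ : t ≤ α + m) : ∃ j, (t, j) ∈ S.cells ∧ S.content (t, j) = c := by
  have h3 := he ⟨t - α, by omega⟩
  generalize e ⟨t - α, by omega⟩ = w at h3
  obtain ⟨⟨⟨i, j⟩, hij⟩, hc⟩ := w
  dsimp only at h3
  obtain rfl : i = t := by omega
  exact ⟨j, hij, hc⟩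

/-- This fixes the relative position of two diagonals even when both consist of one cell, where
convexity gives no information. -/
lemma exists_adj_of_content (hS : CellsConnected S.cells) {d : ℤ}
    (h : ∃ x ∈ S.cells, S.content x = d - 1) (h' : ∃ x ∈ S.cells, S.content x = d) :
    ∃ u ∈ S.cells, ∃ v ∈ S.cells, S.content u = d - 1 ∧ S.content v = d ∧
      (u.1 = v.1 ∨ u.1 = v.1 + 1) := by
  obtain ⟨x, hx, hxc⟩ := h
  obtain ⟨x', hx', hxc'⟩ := h'
  obtain ⟨⟨i, j⟩, ⟨i', j'⟩, ⟨hu, hv, huv⟩, h1, h2⟩ := exists_step_of_reflTransGen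
    (hS.2 x hx x' hx') (fun w => S.content w ≤ d - 1) hxc.le (by omega)
  refine ⟨_, hu, _, hv, ?_⟩
  simp only [content_mk] at *
  rw [CellAdj] at huv
  dsimp only at huv
  omega

lemma linksAgreeOff_link {D : Finset ℤ} {d : ℤ} :
    LinksAgreeOff (fun w : S.cells => S.content w) d (S.Link D) (S.Link (insert d D)) where
  step _ _ h := h.content_eq
  step' _ _ h := h.content_eq
  agree v w hw := by simp only [Link, mem_insert, hw, false_or]

/-- Changing the direction of a diagonal does not change the determinant of the link matrix if at
the same time the entries are pivoted. -/
lemma det_link_insert (hS : CellsConnected S.cells) {R : Type*} [CommRing R] {D : Finset ℤ} {d : ℤ}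
    (hd : d ∉ D) (h : ∃ x ∈ S.cells, S.content x = d - 1) (h' : ∃ x ∈ S.cells, S.content x = d)
    {F F' : ℤ → ℤ → R} (hF : IsPivotPair d F F') :
    (linkMatrix (fun w : S.cells => S.content w) F (S.Link D)).det =
      (linkMatrix (fun w : S.cells => S.content w) F' (S.Link (insert d D))).det := by
  obtain ⟨u₀, hu₀, v₀, hv₀, huc, hvc, huv⟩ := exists_adj_of_content hS h h'
  obtain ⟨α, m, e', he'⟩ := exists_diagonal_equiv h
  obtain ⟨α', m', e, he⟩ := exists_diagonal_equiv h'
  have hrow : ∀ w : S.cells, S.content w = d - 1 → α ≤ w.1.1 ∧ w.1.1 ≤ α + m := by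
    intro w hw
    obtain ⟨k, hk⟩ := e'.surjective ⟨w, hw⟩
    have h1 := he' k
    rw [hk] at h1
    have := k.2
    dsimp only at h1
    omega
  have hrow' : ∀ w : S.cells, S.content w = d → α' ≤ w.1.1 ∧ w.1.1 ≤ α' + m' := by
    intro w hw
    obtain ⟨k, hk⟩ := e.surjective ⟨w, hw⟩
    have h1 := he k
    rw [hk] at h1
    have := k.2
    dsimp only at h1
    omega
  have h0 := hrow ⟨u₀, hu₀⟩ huc
  have h0' := hrow' ⟨v₀, hv₀⟩ hvc
  dsimp only at h0 h0'
  -- Two consecutive cells of diagonal `d - 1` are the corners of a `2 × 2` block, whose upper right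
  -- cell lies on diagonal `d`.
  have hstep : ∀ t, α ≤ t → t < α + m → α' ≤ t ∧ t ≤ α' + m' := by
    intro t h1 h2
    obtain ⟨j, hij, hc⟩ := exists_mem_cells_of_diagonal_equiv e' he' h1 h2.le
    obtain ⟨j', hij', hc'⟩ := exists_mem_cells_of_diagonal_equiv e' he' (t := t + 1) (by omega) h2
    rw [content_mk] at hc hc'
    push_cast at hc'
    have h5 : (t, j + 1) ∈ S.cells := mem_cells_of_le hij hij' (by omega) (by omega) (by omega)
      (by omega)
    exact hrow' ⟨_, h5⟩ (by rw [content_mk]; push_cast; omega)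
  have hstep' : ∀ t, α' ≤ t → t < α' + m' → α ≤ t + 1 ∧ t + 1 ≤ α + m := by
    intro t h1 h2
    obtain ⟨j, hij, hc⟩ := exists_mem_cells_of_diagonal_equiv e he h1 h2.le
    obtain ⟨j', hij', hc'⟩ := exists_mem_cells_of_diagonal_equiv e he (t := t + 1) (by omega) h2
    rw [content_mk] at hc hc'
    push_cast at hc'
    have h5 : (t + 1, j) ∈ S.cells := mem_cells_of_le hij hij' (by omega) (by omega) (by omega)
      (by omega)
    exact hrow ⟨_, h5⟩ (by rw [content_mk]; push_cast; omega)
  have s1 : 0 < m → α' ≤ α := fun hm => (hstep α le_rfl (by omega)).1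
  have s2 : 0 < m → α + m - 1 ≤ α' + m' := fun hm => (hstep (α + m - 1) (by omega) (by omega)).2
  have s3 : 0 < m' → α ≤ α' + 1 := fun hm => (hstep' α' le_rfl (by omega)).1
  have s4 : 0 < m' → α' + m' ≤ α + m := fun hm => by
    have := (hstep' (α' + m' - 1) (by omega) (by omega)).2
    omega
  have hup : ∀ i j, S.Link D (e' i).1 (e j).1 ↔ α + i = α' + j + 1 := by
    intro i j
    have h1 := he' i
    have h2 := he j
    have h3 := (e' i).2
    have h4 := (e j).2
    rw [Link, h4, if_neg hd]
    simp only [content, shiftedContent] at h3 h4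
    omega
  have hright : ∀ i j, S.Link (insert d D) (e' i).1 (e j).1 ↔ α + i = α' + j := by
    intro i j
    have h1 := he' i
    have h2 := he j
    have h3 := (e' i).2
    have h4 := (e j).2
    rw [Link, h4, if_pos (mem_insert_self d D)]
    simp only [content, shiftedContent] at h3 h4
    omega
  -- Interlacing leaves these cases: either diagonal may begin first and either may end last. The
  -- four pivots below correspond to them.
  have hcases : (α = α' + 1 ∧ m' = m) ∨ (α = α' ∧ m' = m) ∨ (α = α' + 1 ∧ m' = m + 1) ∨
      (α = α' ∧ m = m' + 1) := by omega
  obtain ⟨rfl, rfl⟩ | ⟨rfl, rfl⟩ | ⟨rfl, rfl⟩ | ⟨rfl, rfl⟩ := hcases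
  · refine det_linkMatrix_pivot_bijective hF linksAgreeOff_link e e' (fun i j => ?_) fun i j => ?_
    · rw [hup, Fin.ext_iff]
      omega
    · rw [hright]
      omega
  · symm
    -- Here the rightward links are the bijection, so the pivot runs backwards. Both enumerations
    -- are reversed to make the upward links raise the index.
    refine det_linkMatrix_pivot_bijective hF.symm linksAgreeOff_link.symm (Fin.revPerm.trans e)
      (Fin.revPerm.trans e') (fun i j => ?_) fun i j => ?_
    · simp only [Equiv.trans_apply, Fin.revPerm_apply]
      rw [hright, Fin.ext_iff, Fin.val_rev, Fin.val_rev]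
      omega
    · simp only [Equiv.trans_apply, Fin.revPerm_apply]
      rw [hup, Fin.val_rev, Fin.val_rev]
      omega
  · refine det_linkMatrix_pivot_head hF linksAgreeOff_link e e' (fun i j => ?_) fun i j => ?_
    · rw [hup, Fin.ext_iff, Fin.val_castSucc]
      omega
    · rw [hright, Fin.ext_iff, Fin.val_succ]
      omega
  · refine det_linkMatrix_pivot_tail hF linksAgreeOff_link e e' (fun i j => ?_) fun i j => ?_
    · rw [hup, Fin.ext_iff, Fin.val_succ]
      omega
    · rw [hright, Fin.ext_iff, Fin.val_castSucc]
      omega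

lemma det_link_eq_det_link_empty (hS : CellsConnected S.cells) {R : Type*} [CommRing R]
    (H : ℤ → ℤ → R) (h1 : ∀ x, H x x = 1) (h0 : ∀ x y, y < x → H x y = 0) (D : Finset ℤ)
    (hD : ∀ d ∈ D, (∃ x ∈ S.cells, S.content x = d - 1) ∧ ∃ x ∈ S.cells, S.content x = d) :
    (linkMatrix (fun w : S.cells => S.content w) H (S.Link ∅)).det =
      (linkMatrix (fun w : S.cells => S.content w) (ribbonEntry H D) (S.Link D)).det := by
  induction D using Finset.induction_on with
  | empty => rw [ribbonEntry_empty H h1 h0]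
  | insert d D hd ih =>
    rw [ih fun e he => hD e (mem_insert_of_mem he)]
    obtain ⟨h2, h3⟩ := hD d (mem_insert_self d D)
    exact det_link_insert hS hd h2 h3 (isPivotPair_ribbonEntry H hd)

end RShape

/-! ### Contents along a ribbon -/

section Ribbon

variable (S : RShape) {C : Finset (ℕ × ℕ)}

lemma CellsConnected.exists_content_eq (hC : CellsConnected C) {x y : ℕ × ℕ} (hx : x ∈ C)
    (hy : y ∈ C) {c : ℤ} (h₁ : S.content x ≤ c) (h₂ : c ≤ S.content y) :
    ∃ w ∈ C, S.content w = c := by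
  rcases h₂.eq_or_lt with rfl | h₂
  · exact ⟨y, hy, rfl⟩
  obtain ⟨⟨i, j⟩, ⟨i', j'⟩, ⟨hu, hv, huv⟩, h3, h4⟩ := exists_step_of_reflTransGen
    (hC.2 x hx y hy) (fun w => S.content w ≤ c) h₁ (not_le.2 h₂)
  refine ⟨_, hu, ?_⟩
  rw [CellAdj] at huv
  simp only [RShape.content_mk] at *
  omega

lemma IsRibbon.mem_of_le (hC : IsRibbon C) {x y w : ℕ × ℕ} (hx : x ∈ C) (hy : y ∈ C) (hxw : x ≤ w)
    (hwy : w ≤ y) : w ∈ C := by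
  obtain ⟨κ, ν, -, rfl⟩ := hC.2.1
  rw [mem_sdiff] at *
  exact ⟨κ.isLowerSet hwy hy.1, fun h => hx.2 (ν.isLowerSet hxw h)⟩

/-- Two cells of equal content are opposite corners of a square, which by convexity would contain a
forbidden `2 × 2` block. -/
lemma IsRibbon.eq_of_content_eq (hC : IsRibbon C) {x y : ℕ × ℕ} (hx : x ∈ C) (hy : y ∈ C)
    (h : S.content x = S.content y) : x = y := by
  have key : ∀ x y, x ∈ C → y ∈ C → S.content x = S.content y → ¬ x.1 < y.1 := by
    rintro ⟨i, j⟩ ⟨i', j'⟩ hx hy h hlt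
    rw [RShape.content_mk, RShape.content_mk] at h
    dsimp only at hlt
    refine hC.2.2 ⟨i, j, hx, hC.mem_of_le hx hy ?_ ?_, hC.mem_of_le hx hy ?_ ?_,
      hC.mem_of_le hx hy ?_ ?_⟩ <;> rw [Prod.mk_le_mk] <;> omega
  have h1 := key x y hx hy h
  have h2 := key y x hy hx h.symm
  obtain ⟨i, j⟩ := x
  obtain ⟨i', j'⟩ := y
  rw [RShape.content_mk, RShape.content_mk] at h
  rw [Prod.mk.injEq]
  dsimp only at h1 h2
  omega

lemma IsRibbon.step (hC : IsRibbon C) {u w : ℕ × ℕ} (hu : u ∈ C) (hw : w ∈ C)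
    (h : S.content w = S.content u + 1) : w = (u.1, u.2 + 1) ∨ u = (w.1 + 1, w.2) := by
  obtain ⟨x, y, ⟨hx, hy, hxy⟩, h3, h4⟩ := exists_step_of_reflTransGen
    (hC.1.2 u hu w hw) (fun w => S.content w ≤ S.content u) le_rfl (by omega)
  have h5 : S.content x = S.content u ∧ S.content y = S.content w := by
    rw [CellAdj] at hxy
    rw [h]
    obtain ⟨i, j⟩ := x
    obtain ⟨i', j'⟩ := y
    simp only [RShape.content_mk] at *
    omega
  obtain rfl := hC.eq_of_content_eq S hx hu h5.1
  obtain rfl := hC.eq_of_content_eq S hy hw h5.2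
  rw [CellAdj] at hxy
  obtain ⟨i, j⟩ := x
  obtain ⟨i', j'⟩ := y
  simp only [RShape.content_mk, Prod.mk.injEq] at *
  omega

lemma IsHead.content_le {x u : ℕ × ℕ} (hx : IsHead C x) (hu : u ∈ C) :
    S.content x ≤ S.content u := by
  have := hx.2 u hu
  simp only [RShape.content, RShape.shiftedContent]
  omega

lemma IsTail.le_content {x u : ℕ × ℕ} (hx : IsTail C x) (hu : u ∈ C) :
    S.content u ≤ S.content x := by
  have := hx.2 u hu
  simp only [RShape.content, RShape.shiftedContent]
  omega

end Ribbon

/-! ### Directions in an outer decomposition, and the right side as a link determinant -/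

namespace OuterDecomposition

variable {S : RShape} {k : ℕ} (Θ : OuterDecomposition S k)

lemma exists_mem_ribbon {x : ℕ × ℕ} (hx : x ∈ S.cells) : ∃ r, x ∈ Θ.ribbon r := by
  rw [← Θ.cover] at hx
  simpa using hx

variable {Θ}

lemma mem_cells_of_mem_ribbon {x : ℕ × ℕ} {r : Fin k} (hx : x ∈ Θ.ribbon r) : x ∈ S.cells := by
  rw [← Θ.cover]
  exact mem_biUnion.2 ⟨r, mem_univ r, hx⟩

lemma ribbon_unique {x : ℕ × ℕ} {r s : Fin k} (hr : x ∈ Θ.ribbon r) (hs : x ∈ Θ.ribbon s) :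
    r = s := by
  by_contra h
  exact Finset.disjoint_left.1 (Θ.disjoint r s h) hr hs

lemma goesUp_iff {x : ℕ × ℕ} {r : Fin k} (hx : x ∈ Θ.ribbon r) : Θ.GoesUp x ↔
    (0 < x.1 ∧ (x.1 - 1, x.2) ∈ Θ.ribbon r) ∨ (x = Θ.tail r ∧ S.OnTop x) := by
  constructor
  · rintro ⟨s, hs, h⟩
    obtain rfl := ribbon_unique hx hs
    exact h
  · exact fun h => ⟨r, hx, h⟩

/-- Such a cell is not a tail: a tail on the top perimeter goes up, and one on the right perimeter
has no right neighbour. So its ribbon continues, and not upwards. -/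
lemma mem_ribbon_right {i j : ℕ} {r : Fin k} (hx : (i, j) ∈ Θ.ribbon r)
    (hw : (i, j + 1) ∈ S.cells) (h : ¬ Θ.GoesUp (i, j)) : (i, j + 1) ∈ Θ.ribbon r := by
  rw [goesUp_iff hx, not_or] at h
  by_cases ht : (i, j) = Θ.tail r
  · exfalso
    rcases Θ.tail_outer r with h1 | h1
    · exact h.2 ⟨ht, ht ▸ h1⟩
    · rw [← ht] at h1
      exact h1 hw
  · have h1 := (Θ.isTail r).le_content S hx
    have h2 : S.content (i, j) ≠ S.content (Θ.tail r) := fun h2 =>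
      ht ((Θ.isRibbon r).eq_of_content_eq S hx (Θ.isTail r).1 h2)
    obtain ⟨w, hw, hc⟩ := (Θ.isRibbon r).1.exists_content_eq S (c := S.content (i, j) + 1) hx
      (Θ.isTail r).1 (by omega) (by omega)
    rcases (Θ.isRibbon r).step S hx hw hc with rfl | h3
    · exact hw
    · rw [Prod.mk.injEq] at h3
      refine absurd ⟨by dsimp only; omega, ?_⟩ h.1
      convert hw using 1
      exact Prod.ext (by dsimp only; omega) h3.2

lemma mem_ribbon_above {i j : ℕ} {r : Fin k} (hx : (i + 1, j) ∈ Θ.ribbon r)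
    (hw : (i, j) ∈ S.cells) (h : Θ.GoesUp (i + 1, j)) : (i, j) ∈ Θ.ribbon r := by
  rw [goesUp_iff hx] at h
  rcases h with h | ⟨-, h | h⟩
  · exact h.2
  · simp at h
  · exact absurd hw h

lemma not_goesUp {i j : ℕ} {r : Fin k} (hx : (i, j) ∈ Θ.ribbon r) (hw : (i, j + 1) ∈ Θ.ribbon r) :
    ¬ Θ.GoesUp (i, j) := by
  rw [goesUp_iff hx]
  rintro (⟨h1, h2⟩ | ⟨h1, -⟩)
  · have := (Θ.isRibbon r).eq_of_content_eq S h2 hw (by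
      simp only [RShape.content_mk] at *
      omega)
    rw [Prod.mk.injEq] at this
    omega
  · have := (Θ.isTail r).le_content S hw
    rw [← h1, RShape.content_mk, RShape.content_mk] at this
    push_cast at this
    omega

lemma goesUp_of_mem {i j : ℕ} {r : Fin k} (hx : (i + 1, j) ∈ Θ.ribbon r)
    (hw : (i, j) ∈ Θ.ribbon r) : Θ.GoesUp (i + 1, j) :=
  (goesUp_iff hx).2 (Or.inl ⟨Nat.succ_pos i, hw⟩)

/-- The cell `(i, j + 1)` has a left and a lower neighbour, so it is no head and is entered from
exactly one of `(i, j)` and `(i + 1, j + 1)`. If the first went up and the second right, neither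
would enter it; in the opposite case both would, and its ribbon would have two cells of the same
content. -/
lemma goesUp_diagonal_succ {i j : ℕ} (hx : (i, j) ∈ S.cells) (hx' : (i + 1, j + 1) ∈ S.cells) :
    Θ.GoesUp (i, j) ↔ Θ.GoesUp (i + 1, j + 1) := by
  have hw : (i, j + 1) ∈ S.cells :=
    RShape.mem_cells_of_le hx hx' le_rfl (by omega) (by omega) le_rfl
  obtain ⟨r, hr⟩ := Θ.exists_mem_ribbon hx
  obtain ⟨r', hr'⟩ := Θ.exists_mem_ribbon hx'
  obtain ⟨s, hs⟩ := Θ.exists_mem_ribbon hw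
  constructor
  · intro h
    by_contra h'
    by_cases hh : (i, j + 1) = Θ.head s
    · rcases Θ.head_outer s with h1 | h1 <;> rw [← hh] at h1
      · rcases h1 with h1 | h1
        · simp at h1
        · exact h1 hx
      · exact h1 hx'
    · have h1 := (Θ.isHead s).content_le S hs
      have h2 : S.content (i, j + 1) ≠ S.content (Θ.head s) := fun h2 =>
        hh ((Θ.isRibbon s).eq_of_content_eq S hs (Θ.isHead s).1 h2)
      obtain ⟨u, hu, hc⟩ := (Θ.isRibbon s).1.exists_content_eq S (c := S.content (i, j + 1) - 1)
        (Θ.isHead s).1 hs (by omega) (by omega)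
      rcases (Θ.isRibbon s).step S hu hs (by omega) with h3 | h3
      · have h4 : u = (i, j) := by
          rw [Prod.mk.injEq] at h3
          exact Prod.ext h3.1.symm (by dsimp only; omega)
        exact not_goesUp (h4 ▸ hu) hs h
      · exact h' (goesUp_of_mem (h3 ▸ hu) hs)
  · intro h
    by_contra h'
    have h1 := mem_ribbon_above hr' hw h
    obtain rfl := ribbon_unique h1 (mem_ribbon_right hr hw h')
    have h2 := (Θ.isRibbon r').eq_of_content_eq S hr hr' (by
      rw [RShape.content_mk, RShape.content_mk]
      push_cast
      ring)
    simp at h2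

lemma goesUp_diagonal {i j : ℕ} (n : ℕ) (hx : (i, j) ∈ S.cells)
    (hx' : (i + n, j + n) ∈ S.cells) : Θ.GoesUp (i, j) ↔ Θ.GoesUp (i + n, j + n) := by
  induction n with
  | zero => rfl
  | succ n ih =>
    have h : (i + n, j + n) ∈ S.cells :=
      RShape.mem_cells_of_le hx hx' (by omega) (by omega) (by omega) (by omega)
    refine Iff.trans ?_ (goesUp_diagonal_succ h hx')
    exact ih h

/-- All cells with the same content have the same direction. -/
lemma stripUp_iff {x : ℕ × ℕ} (hx : x ∈ S.cells) : Θ.StripUp (S.content x) ↔ Θ.GoesUp x := by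
  refine ⟨?_, fun h => ⟨x, hx, rfl, h⟩⟩
  rintro ⟨y, hy, hc, h⟩
  obtain ⟨i, j⟩ := x
  obtain ⟨i', j'⟩ := y
  rw [RShape.content_mk, RShape.content_mk] at hc
  rcases le_total i i' with hi | hi
  · obtain ⟨n, rfl⟩ := Nat.exists_eq_add_of_le hi
    obtain rfl : j' = j + n := by push_cast at hc; omega
    exact (goesUp_diagonal n hx hy).2 h
  · obtain ⟨n, rfl⟩ := Nat.exists_eq_add_of_le hi
    obtain rfl : j = j' + n := by push_cast at hc; omega
    exact (goesUp_diagonal n hy hx).1 h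

variable (Θ)

open Classical in
/-- The contents of the cells that are entered from the left. -/
noncomputable def rightSteps : Finset ℤ :=
  {d ∈ S.cells.image S.content | (∃ x ∈ S.cells, S.content x = d - 1) ∧ ¬ Θ.StripUp (d - 1)}

variable {Θ}

lemma mem_rightSteps_iff {d : ℤ} : d ∈ Θ.rightSteps ↔ (∃ x ∈ S.cells, S.content x = d) ∧
    (∃ x ∈ S.cells, S.content x = d - 1) ∧ ¬ Θ.StripUp (d - 1) := by
  classical
  rw [rightSteps, mem_filter, mem_image]

lemma mem_rightSteps {d : ℤ} (h : ∃ x ∈ S.cells, S.content x = d)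
    (h' : ∃ x ∈ S.cells, S.content x = d - 1) : d ∈ Θ.rightSteps ↔ ¬ Θ.StripUp (d - 1) := by
  rw [mem_rightSteps_iff]
  exact ⟨fun hd => hd.2.2, fun hd => ⟨h, h', hd⟩⟩

lemma mem_rightSteps_of_content_eq {v w : ℕ × ℕ} (hv : v ∈ S.cells) (hw : w ∈ S.cells)
    (h : S.content w = S.content v + 1) : S.content w ∈ Θ.rightSteps ↔ ¬ Θ.GoesUp v := by
  have h1 : S.content w - 1 = S.content v := by omega
  rw [mem_rightSteps ⟨w, hw, rfl⟩ ⟨v, hv, h1.symm⟩, h1, stripUp_iff hv]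

/-- With the right steps as the set of turned diagonals, links are precisely the steps inside the
ribbons, so the chains are the ribbons. -/
lemma link_iff {v w : S.cells} {r s : Fin k} (hv : v.1 ∈ Θ.ribbon r) (hw : w.1 ∈ Θ.ribbon s) :
    S.Link Θ.rightSteps v w ↔ r = s ∧ S.content w = S.content v + 1 := by
  constructor
  · intro h
    have hc := h.content_eq
    refine ⟨?_, hc⟩
    have hd := mem_rightSteps_of_content_eq (Θ := Θ) v.2 w.2 hc
    rw [RShape.Link] at h
    obtain ⟨⟨i, j⟩, hv'⟩ := v
    obtain ⟨⟨i', j'⟩, hw'⟩ := w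
    split_ifs at h with h1 <;> dsimp only at h
    · obtain ⟨rfl, rfl⟩ := h
      exact ribbon_unique (mem_ribbon_right hv hw' (hd.1 h1)) hw
    · obtain ⟨rfl, rfl⟩ := h
      exact ribbon_unique (mem_ribbon_above hv hw' (not_not.1 (mt hd.2 h1))) hw
  · rintro ⟨rfl, hc⟩
    have hd := mem_rightSteps_of_content_eq (Θ := Θ) v.2 w.2 hc
    rw [RShape.Link]
    obtain ⟨⟨i, j⟩, hv'⟩ := v
    obtain ⟨⟨i', j'⟩, hw'⟩ := w
    rcases (Θ.isRibbon r).step S hv hw hc with h | h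
    · obtain ⟨rfl, rfl⟩ := Prod.mk.injEq .. ▸ h
      rw [if_pos (hd.2 (not_goesUp hv hw))]
      exact ⟨rfl, rfl⟩
    · obtain ⟨rfl, rfl⟩ := Prod.mk.injEq .. ▸ h
      rw [if_neg (mt hd.1 (not_not.2 (goesUp_of_mem hv hw)))]
      exact ⟨rfl, rfl⟩

lemma det_link_rightSteps {R : Type*} [CommRing R] (F : ℤ → ℤ → R) :
    (linkMatrix (fun w : S.cells => S.content w) F (S.Link Θ.rightSteps)).det =
      (Matrix.of fun i j : Fin k =>
        F (S.content (Θ.head i)) (S.content (Θ.tail j) + 1)).det := by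
  choose r hr using fun w : S.cells => Θ.exists_mem_ribbon w.2
  refine det_linkMatrix_eq_det_chains _ F _ r (fun i => S.content (Θ.head i))
    (fun i => S.content (Θ.tail i)) ?_ ?_ ?_ ?_ ?_
  · exact fun i => (Θ.isHead i).content_le S (Θ.isTail i).1
  · exact fun w => ⟨(Θ.isHead _).content_le S (hr w), (Θ.isTail _).le_content S (hr w)⟩
  · intro i x h1 h2
    obtain ⟨w, hw, rfl⟩ := (Θ.isRibbon i).1.exists_content_eq S (Θ.isHead i).1 (Θ.isTail i).1 h1 h2
    exact ⟨⟨w, mem_cells_of_mem_ribbon hw⟩, ribbon_unique (hr _) hw, rfl⟩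
  · intro v w h1 h2
    exact Subtype.ext ((Θ.isRibbon (r w)).eq_of_content_eq S (h1 ▸ hr v) (hr w) h2)
  · exact fun v w => link_iff (hr v) (hr w)

/-- The induced flags are the content flags, so every entry is a minor of the same array. The upper
argument is `c(γ_j) + 1`, so the empty ribbon `p = q + 1` falls on the diagonal and the undefined
ones below it. -/
lemma entry_eq_ribbonEntry (hS : CellsConnected S.cells) {R : Type*} [CommRing R] (a b : ℕ → ℤ)
    (y z : ℤ → R) (i j : Fin k) : Θ.entry a b y z i j =
      ribbonEntry (S.columnFunction a b y z) Θ.rightSteps (S.content (Θ.head i))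
        (S.content (Θ.tail j) + 1) := by
  classical
  rw [entry]
  split_ifs with h1 h2
  · refine Eq.trans ?_ (stripShape_det Θ.StripUp _ (S.columnFunction_self a b y z)
      (S.columnFunction_of_lt a b y z) _ h1 ?_)
    · change _ = (Matrix.of fun s t : Fin (Θ.hash i j).numCols => S.columnFunction a b y z
        ((Θ.hash i j).bottomContent s) ((Θ.hash i j).topContent t + 1)).det
      rw [RShape.flaggedSchur]
      congr 1
      ext s t
      rw [Matrix.of_apply, Matrix.of_apply, RShape.columnFunction, add_sub_cancel_right]
      simp only [inducedA, inducedB, RShape.contentFlagA, RShape.contentFlagB]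
      congr 1
      simp only [RShape.topContent, RShape.bottomContent, RShape.shiftedContent]
      ring
    -- Connectedness ensures that every content between that of the head and that of the tail occurs
    -- in the diagram, so the strip's directions there are governed by `rightSteps`.
    · intro d h2 h3
      have hh := mem_cells_of_mem_ribbon (Θ.isHead i).1
      have ht := mem_cells_of_mem_ribbon (Θ.isTail j).1
      exact mem_rightSteps (hS.exists_content_eq S hh ht h2.le h3)
        (hS.exists_content_eq S hh ht (by omega) (by omega))
  · rw [ribbonEntry, if_pos h2]
  · rw [ribbonEntry, if_neg h2, if_pos (by omega)]

end OuterDecomposition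

theorem mainTheorem1 {R : Type*} [CommRing R] (S : RShape) (hS : CellsConnected S.cells)
    {k : ℕ} (Θ : OuterDecomposition S k)
    (n : ℕ) (hn : S.numCols ≤ n) (a b : ℕ → ℤ) (hab : S.IsColumnFlags a b) (y z : ℤ → R) :
    S.flaggedSchur n a b y z =
      Matrix.det (Matrix.of fun i j : Fin k => Θ.entry a b y z i j) := by
  rw [RShape.flaggedSchur_eq_det_link a b y z hS hn,
    RShape.det_link_eq_det_link_empty hS _ (S.columnFunction_self a b y z)
      (S.columnFunction_of_lt a b y z) Θ.rightSteps, OuterDecomposition.det_link_rightSteps]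
  · simp only [OuterDecomposition.entry_eq_ribbonEntry hS]
  · intro d hd
    rw [OuterDecomposition.mem_rightSteps_iff] at hd
    exact ⟨hd.2.1, hd.1⟩
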